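/- Let $k$ be a field and let $1 \le a < b < d$ be integers with $b \ge a+2$. Let $R = k[x^{\alpha}y^{d-\alpha} : \alpha \in [0,a]\cup[b,d]] \subseteq k[x,y]$, where $[u,v]$ denotes the set of integers $\alpha$ with $u\le\alpha\le v$, graded so that the generators $x^{\alpha}y^{d-\alpha}$ have degree $1$. Let $R_+=\bigoplus_{n\ge1}R_n$ and let $Q=(x^d,y^d)$ be the ideal of $R$ generated by $x^d$ and $y^d$. Then $R$ is not a Cohen–Macaulay ring, $Q$ is a reduction of $R_+$, and $$\operatorname{reg}(R) = r_Q(R_+) = \begin{cases} \left\lceil\dfrac{b-1}{a}\right\rceil & \text{if } d-b\ge a,\\[2mm] \left\lceil\dfrac{d-a-1}{d-b}\right\rceil & \text{if } d-b<a.\end{cases}$$ Here an ideal $J\subseteq I$ is a reduction of $I$ if $JI^r=I^{r+1}$ for some $r\ge0$, and $r_J(I)$ is the least such $r$; and $\operatorname{reg}(R)=\max_i\{b_i-i\}$ is the Castelnuovo–Mumford regularity, where $b_i$ is the maximal degree of the generators of the $i$-th module $F_i \neq 0$ in a minimal graded free resolution of $R$ over the standard graded polynomial ring $S=k[T_\alpha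 : \alpha\in[0,a]\cup[b,d]]$, which maps onto $R$ by $T_\alpha\mapsto x^\alpha y^{d-\alpha}$. -/

import Mathlib

/-! ### Reductions of ideals -/

/-- `J` is a reduction of `I`: `J ⊆ I` and `J I ^ r = I ^ (r + 1)` for some `r ≥ 0`. -/
def IsReduction {R : Type*} [CommRing R] (J I : Ideal R) : Prop :=
  J ≤ I ∧ ∃ r : ℕ, J * I ^ r = I ^ (r + 1)

/-- The reduction number of `I` with respect to a reduction `J`: the least `r` with
`J I ^ r = I ^ (r + 1)`. It is meaningful when `IsReduction J I` holds. -/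
noncomputable def reductionNumber {R : Type*} [CommRing R] (J I : Ideal R) : ℕ :=
  sInf {r : ℕ | J * I ^ r = I ^ (r + 1)}

/-! ### Cohen-Macaulay rings -/

/-- A (Noetherian) local ring is Cohen-Macaulay if its maximal ideal contains a regular sequence
whose length is the Krull dimension of the ring. -/
def IsCohenMacaulayLocal (A : Type*) [CommRing A] [IsLocalRing A] : Prop :=
  ∃ rs : List A, (∀ r ∈ rs, r ∈ IsLocalRing.maximalIdeal A) ∧
    RingTheory.Sequence.IsRegular A rs ∧ ((rs.length : ℕ∞) : WithBot ℕ∞) = ringKrullDim A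

/-- A (Noetherian) ring is Cohen-Macaulay if all its localizations at prime ideals are. -/
def IsCohenMacaulay (A : Type*) [CommRing A] : Prop :=
  ∀ (p : Ideal A) [p.IsPrime], IsCohenMacaulayLocal (Localization.AtPrime p)

/-! ### Minimal graded free resolutions and Castelnuovo-Mumford regularity -/

/-- A minimal graded free resolution `⋯ → F₁ → F₀ → N → 0`, by free modules of finite rank, of a
module `N` graded by `𝒩` over the standard graded polynomial ring `S = k[T_s : s ∈ σ]`.
Here `F i = ⨁ₑ S(-deg i e)` with `e` running over `Fin (rank i)`. The length is not required to be
finite: for `σ` finite that is automatic by Hilbert's syzygy theorem. -/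
structure MinimalGradedFreeResolution {k σ N : Type*} [Field k] [AddCommGroup N] [Module k N]
    [Module (MvPolynomial σ k) N] (𝒩 : ℕ → Submodule k N) where
  /-- The rank of `F i`. -/
  rank : ℕ → ℕ
  /-- The degrees of the basis elements of `F i`. -/
  deg : (i : ℕ) → Fin (rank i) → ℕ
  /-- The augmentation `F 0 → N`. -/
  aug : (Fin (rank 0) → MvPolynomial σ k) →ₗ[MvPolynomial σ k] N
  /-- The differential `F (i + 1) → F i`. -/
  d : (i : ℕ) → (Fin (rank (i + 1)) → MvPolynomial σ k) →ₗ[MvPolynomial σ k]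
    (Fin (rank i) → MvPolynomial σ k)
  /-- The augmentation is homogeneous of degree `0`. -/
  aug_homogeneous : ∀ e, aug (Pi.single e 1) ∈ 𝒩 (deg 0 e)
  /-- The differentials are homogeneous of degree `0`: the matrix entry in row `f` and column `e`
  is homogeneous of degree `deg (i + 1) e - deg i f` (and is zero if that number is negative). -/
  d_homogeneous : ∀ i e f, d i (Pi.single e 1) f = 0 ∨
    ∃ n : ℕ, deg i f + n = deg (i + 1) e ∧ (d i (Pi.single e 1) f).IsHomogeneous n
  aug_surjective : Function.Surjective aug
  exact_zero : Function.Exact (d 0) aug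
  exact_succ : ∀ i, Function.Exact (d (i + 1)) (d i)
  /-- Minimality: the matrix entries of the differentials lie in the ideal generated by the
  variables. -/
  minimal : ∀ i e f, MvPolynomial.constantCoeff (d i (Pi.single e 1) f) = 0

/-- The Castelnuovo-Mumford regularity of the graded module `N` over `S` is `r`: there are
minimal graded free resolutions of `N` and, for each of them, `r` is the maximum of the numbers
`b - i`, where `b` is the degree of a basis element of `F i`. -/
def HasRegularity {k σ N : Type*} [Field k] [AddCommGroup N] [Module k N]
    [Module (MvPolynomial σ k) N] (𝒩 : ℕ → Submodule k N) (r : ℤ) : Prop :=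
  Nonempty (MinimalGradedFreeResolution (σ := σ) 𝒩) ∧
    ∀ F : MinimalGradedFreeResolution (σ := σ) 𝒩,
      IsGreatest {t : ℤ | ∃ (i : ℕ) (e : Fin (F.rank i)), t = (F.deg i e : ℤ) - i} r

/-! ### Coordinate rings of projective monomial curves -/

namespace MonomialCurve

open MvPolynomial

variable (k : Type*) [Field k] (d : ℕ) (E : Set ℕ)

/-- The monomial `x ^ α * y ^ (d - α)` in `k[x, y]`, with `x = X 0` and `y = X 1`. -/
noncomputable def mono (α : ℕ) : MvPolynomial (Fin 2) k := X 0 ^ α * X 1 ^ (d - α)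

/-- The algebra `R = k[x ^ α * y ^ (d - α) : α ∈ E]`, for a set `E` of numbers `≤ d`. -/
noncomputable def coordRing : Subalgebra k (MvPolynomial (Fin 2) k) :=
  Algebra.adjoin k (mono k d '' E)

/-- The graded piece `R_n`, for the grading in which the generators `x ^ α * y ^ (d - α)` have
degree `1`: the elements of `R` that are homogeneous of degree `n * d` in `x, y`. -/
noncomputable def piece (n : ℕ) : Submodule k (coordRing k d E) :=
  (homogeneousSubmodule (Fin 2) k (n * d)).comap (coordRing k d E).val.toLinearMap

/-- The ideal `R_+` generated by the homogeneous elements of positive degree. -/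
noncomputable def irrelevant : Ideal (coordRing k d E) :=
  Ideal.span {f | ∃ n : ℕ, 1 ≤ n ∧ f ∈ piece k d E n}

/-- The ideal `Q = (x ^ d, y ^ d)` of `R` (for `0, d ∈ E`). -/
noncomputable def Q : Ideal (coordRing k d E) :=
  Ideal.span {f | (f : MvPolynomial (Fin 2) k) = X 0 ^ d ∨ (f : MvPolynomial (Fin 2) k) = X 1 ^ d}

/-- The presentation of `R` as a quotient of `S = k[T_α : α ∈ E]`, by `T_α ↦ x ^ α * y ^ (d - α)`. -/
noncomputable def presentation : MvPolynomial E k →ₐ[k] coordRing k d E :=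
  aeval fun α : E => ⟨mono k d α, Algebra.subset_adjoin ⟨α, α.2, rfl⟩⟩

theorem presentation_surjective : Function.Surjective (presentation k d E) := by
  have h : ((coordRing k d E).val.comp (presentation k d E)).range = coordRing k d E := by
    have h₁ : (coordRing k d E).val.comp (presentation k d E) =
        aeval fun α : E => mono k d α := by
      ext α
      simp [presentation]
    rw [h₁, ← Algebra.adjoin_range_eq_range_aeval, coordRing, Set.image_eq_range]
  intro f
  have hf : (f : MvPolynomial (Fin 2) k) ∈
      ((coordRing k d E).val.comp (presentation k d E)).range := by
    rw [h]
    exact f.2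
  obtain ⟨p, hp⟩ := hf
  exact ⟨p, Subtype.ext hp⟩

/-- `R` as a module over `S = k[T_α : α ∈ E]` through the presentation. -/
noncomputable instance instModuleCoordRing : Module (MvPolynomial E k) (coordRing k d E) :=
  Module.compHom _ (presentation k d E).toRingHom

/-- `reg R = r`, by means of minimal graded free resolutions of `R` over `S = k[T_α : α ∈ E]`. -/
def HasReg (r : ℤ) : Prop := HasRegularity (σ := E) (piece k d E) r

end MonomialCurve

/-! Everything is governed by the sumsets of `E`. A monomial of degree `n * d` lies in `R` iff its
`x`-exponent is a sum of `n` elements of `E` (`mem_coordRing_iff`), and these sums fill the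
intervals `[j * b, i * a + j * d]` with `i + j = n`. Comparing neighbouring intervals produces the
number `r` of the formula (`exists_conductor`): from degree `r` on, `R` contains all monomials,
while for every `n < r` some `(n + 1)`-fold sum is neither `0` nor `d` plus an `n`-fold sum. Hence
`r` is the reduction number (`Q_mul_irrelevant_pow`, `Q_mul_irrelevant_pow_ne`).

For `n = r - 1` this leaves a monomial `h` of degree `r - 1` (in the grading of `R`) outside `R`
with `R_+ h ⊆ R`, that is, a nonzero class in the first local cohomology. Thus the depth at the
vertex is at most one while the height is at least two, and `R` is not Cohen–Macaulay.

The regularity is read off the resolution by following regular sequences through syzygies. Upper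
bound: in degrees above `r`, `y^d, x^d` is a regular sequence and the quotient by it vanishes, so
all variables form a regular sequence there. A syzygy module inherits this with the bound raised by
one, and minimality then gives `deg ≤ r + i` on `F i` (`degree_le`). Lower bound: `y^d h` is a socle
element of degree `r` in `R / y^d R`. Each passage to syzygies moves it up by one degree and adds
one variable to the sequence (`HasSocle.syzygy`). Once all variables are used, it forces a basis
element of degree `r + i` in `F i`, where `i` is the number of variables minus one
(`exists_degree_eq`). -/

set_option linter.unusedSectionVars false

/-! ### Regular sequences of variables and socle elements under passage to syzygies -/

section GradedSyzygies

open MvPolynomial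

variable {k σ M : Type*} [Field k] [AddCommGroup M] [Module k M] [Module (MvPolynomial σ k) M]
  [IsScalarTower k (MvPolynomial σ k) M]

/-- Multiplication by the variable `X s`, as a `k`-linear map. -/
noncomputable def varMul (s : σ) : M →ₗ[k] M where
  toFun z := (X s : MvPolynomial σ k) • z
  map_add' := smul_add _
  map_smul' c z := smul_algebra_smul_comm c (X s : MvPolynomial σ k) z

@[simp] theorem varMul_apply (s : σ) (z : M) :
    varMul (k := k) s z = (X s : MvPolynomial σ k) • z := rfl

/-- The subspace `∑ X s • P`, with `s` running over the list `L`. -/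
noncomputable def varSpan : List σ → Submodule k M → Submodule k M
  | [], _ => ⊥
  | s :: L, P => P.map (varMul s) ⊔ varSpan L P

theorem mem_varSpan_cons {s : σ} {L : List σ} {P : Submodule k M} {z : M} :
    z ∈ varSpan (s :: L) P ↔
      ∃ w ∈ P, ∃ y ∈ varSpan L P, (X s : MvPolynomial σ k) • w + y = z := by
  simp [varSpan, Submodule.mem_sup]

theorem varSpan_mono {L : List σ} {P P' : Submodule k M} (h : P ≤ P') :
    varSpan L P ≤ varSpan L P' := by
  induction L with
  | nil => exact le_rfl
  | cons s L ih => exact sup_le_sup (Submodule.map_mono h) ih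

theorem smul_mem_varSpan_of_mem {s : σ} {L : List σ} (hs : s ∈ L) {P : Submodule k M} {w : M}
    (hw : w ∈ P) : (X s : MvPolynomial σ k) • w ∈ varSpan L P := by
  induction L with
  | nil => simp at hs
  | cons t L ih =>
    rcases List.mem_cons.1 hs with rfl | h
    · exact (le_sup_left : P.map (varMul s) ≤ _) ⟨w, hw, rfl⟩
    · exact (le_sup_right : varSpan L P ≤ _) (ih h)

theorem varSpan_le_iff {L : List σ} {P K : Submodule k M} :
    varSpan L P ≤ K ↔ ∀ s ∈ L, ∀ w ∈ P, (X s : MvPolynomial σ k) • w ∈ K := by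
  refine ⟨fun h s hs w hw => h (smul_mem_varSpan_of_mem hs hw), fun h => ?_⟩
  induction L with
  | nil => exact bot_le
  | cons s L ih =>
    refine sup_le ?_ (ih fun t ht => h t (List.mem_cons_of_mem _ ht))
    rintro _ ⟨w, hw, rfl⟩
    exact h s List.mem_cons_self w hw

theorem smul_mem_varSpan {L : List σ} {P P' : Submodule k M} (s : σ)
    (h : ∀ w ∈ P, (X s : MvPolynomial σ k) • w ∈ P') {v : M} (hv : v ∈ varSpan L P) :
    (X s : MvPolynomial σ k) • v ∈ varSpan L P' := by
  have : varSpan L P ≤ (varSpan L P').comap (varMul s) := by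
    refine varSpan_le_iff.2 fun t ht w hw => ?_
    rw [Submodule.mem_comap, varMul_apply, smul_comm]
    exact smul_mem_varSpan_of_mem ht (h w hw)
  exact this hv

/-- In degrees greater than `c`, the variables in the list `L`, from the last one to the first,
form a regular sequence on the graded module with pieces `𝒩 j`. -/
def RegularFrom : List σ → ℕ → (ℕ → Submodule k M) → Prop
  | [], _, _ => True
  | s :: L, c, 𝒩 => (∀ j, c ≤ j → ∀ z ∈ 𝒩 (j + 1),
      (X s : MvPolynomial σ k) • z ∈ varSpan L (𝒩 (j + 1)) → z ∈ varSpan L (𝒩 j)) ∧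
      RegularFrom L c 𝒩

/-- The degree `j` piece of the graded free module with basis elements of degrees `deg e`. -/
noncomputable def freePiece (k σ : Type*) [Field k] {n : ℕ} (deg : Fin n → ℕ) (j : ℕ) :
    Submodule k (Fin n → MvPolynomial σ k) :=
  Submodule.pi Set.univ fun e =>
    if deg e ≤ j then homogeneousSubmodule σ k (j - deg e) else ⊥

theorem mem_freePiece {n : ℕ} {deg : Fin n → ℕ} {j : ℕ} {f : Fin n → MvPolynomial σ k} :
    f ∈ freePiece k σ deg j ↔
      ∀ e, (deg e ≤ j → (f e).IsHomogeneous (j - deg e)) ∧ (j < deg e → f e = 0) := by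
  simp only [freePiece, Submodule.mem_pi, Set.mem_univ, true_imp_iff]
  refine forall_congr' fun e => ?_
  split_ifs with h
  · simp [h, Nat.not_lt.2 h]
  · simp [h, Nat.lt_of_not_le h]

theorem single_mem_freePiece {n : ℕ} (deg : Fin n → ℕ) (e : Fin n) :
    (Pi.single e 1 : Fin n → MvPolynomial σ k) ∈ freePiece k σ deg (deg e) := by
  classical
  refine mem_freePiece.2 fun f => ?_
  rcases eq_or_ne f e with rfl | h
  · simpa using isHomogeneous_one σ k
  · simp only [Pi.single_eq_of_ne h]
    exact ⟨fun _ => isHomogeneous_zero _ _ _, fun _ => trivial⟩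

theorem single_mem_freePiece_of_isHomogeneous {n : ℕ} {deg : Fin n → ℕ} {e : Fin n} {m j : ℕ}
    {p : MvPolynomial σ k} (hp : p.IsHomogeneous m) (h : deg e + m = j) :
    (Pi.single e p : Fin n → MvPolynomial σ k) ∈ freePiece k σ deg j := by
  classical
  refine mem_freePiece.2 fun f => ?_
  rcases eq_or_ne f e with rfl | hf
  · rw [Pi.single_eq_same]
    refine ⟨fun _ => ?_, fun h' => by omega⟩
    rwa [show j - deg f = m by omega]
  · simp only [Pi.single_eq_of_ne hf]
    exact ⟨fun _ => isHomogeneous_zero _ _ _, fun _ => trivial⟩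

theorem smul_mem_freePiece {n : ℕ} {deg : Fin n → ℕ} {j m : ℕ} {p : MvPolynomial σ k}
    (hp : p.IsHomogeneous m) {f : Fin n → MvPolynomial σ k} (hf : f ∈ freePiece k σ deg j) :
    p • f ∈ freePiece k σ deg (j + m) := by
  refine mem_freePiece.2 fun e => ?_
  have := mem_freePiece.1 hf e
  rw [Pi.smul_apply, smul_eq_mul]
  by_cases h : deg e ≤ j
  · refine ⟨fun _ => ?_, fun h' => by omega⟩
    rw [show j + m - deg e = m + (j - deg e) by omega]
    exact hp.mul (this.1 h)
  · rw [this.2 (not_le.1 h), mul_zero]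
    exact ⟨fun _ => isHomogeneous_zero _ _ _, fun _ => rfl⟩

theorem X_smul_mem_freePiece {n : ℕ} {deg : Fin n → ℕ} {j : ℕ} (s : σ)
    {f : Fin n → MvPolynomial σ k} (hf : f ∈ freePiece k σ deg j) :
    (X s : MvPolynomial σ k) • f ∈ freePiece k σ deg (j + 1) :=
  smul_mem_freePiece (isHomogeneous_X k s) hf

/-- A homogeneous polynomial all of whose monomials involve a variable from `L`. -/
theorem single_mem_varSpan {L : List σ} {n : ℕ} {deg : Fin n → ℕ} {e : Fin n} {j : ℕ}
    {p : MvPolynomial σ k} (hp : ∀ m ∈ p.support, deg e + m.degree = j + 1)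
    (hL : ∀ m ∈ p.support, ∃ s ∈ L, m s ≠ 0) :
    (Pi.single e p : Fin n → MvPolynomial σ k) ∈ varSpan L (freePiece k σ deg j) := by
  classical
  have : (Pi.single e p : Fin n → MvPolynomial σ k) =
      ∑ m ∈ p.support, Pi.single e (monomial m (coeff m p)) := by
    conv_lhs => rw [p.as_sum]
    exact map_sum (AddMonoidHom.single (fun _ : Fin n => MvPolynomial σ k) e) _ _
  rw [this]
  refine Submodule.sum_mem _ fun m hm => ?_
  obtain ⟨s, hs, hms⟩ := hL m hm
  have h1 : Finsupp.single s 1 ≤ m := by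
    rw [Finsupp.single_le_iff]
    omega
  have h2 : monomial m (coeff m p) =
      (X s : MvPolynomial σ k) * monomial (m - Finsupp.single s 1) (coeff m p) := by
    rw [X, monomial_mul, one_mul, add_tsub_cancel_of_le h1]
  rw [h2, ← smul_eq_mul, Pi.single_smul]
  refine smul_mem_varSpan_of_mem hs (single_mem_freePiece_of_isHomogeneous
    (isHomogeneous_monomial _ rfl) ?_)
  have h3 : (m - Finsupp.single s 1).degree + 1 = m.degree := by
    conv_rhs => rw [← tsub_add_cancel_of_le h1]
    rw [map_add, Finsupp.degree_single]
  have := hp m hm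
  omega

/-- All coefficients of monomials without variables from `L` vanish on `varSpan L`. -/
theorem coeff_eq_zero_of_mem_varSpan {L : List σ} {n : ℕ}
    {P : Submodule k (Fin n → MvPolynomial σ k)} {f : Fin n → MvPolynomial σ k}
    (hf : f ∈ varSpan L P) (e : Fin n) {m : σ →₀ ℕ} (hm : ∀ s ∈ L, m s = 0) :
    coeff m (f e) = 0 := by
  have : varSpan L P ≤ LinearMap.ker ((lcoeff k m).comp (LinearMap.proj e)) := by
    refine varSpan_le_iff.2 fun s hs w _ => ?_
    classical
    simp [coeff_X_mul', hm s hs]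
  simpa using this hf

theorem support_degree_of_mem_freePiece {n : ℕ} {deg : Fin n → ℕ} {j : ℕ}
    {f : Fin n → MvPolynomial σ k} (hf : f ∈ freePiece k σ deg j) (e : Fin n) {m : σ →₀ ℕ}
    (hm : m ∈ (f e).support) : deg e + m.degree = j := by
  obtain ⟨h1, h2⟩ := mem_freePiece.1 hf e
  by_cases h : deg e ≤ j
  · have h3 : m.degree = j - deg e := by
      by_contra h3
      exact mem_support_iff.1 hm ((h1 h).coeff_eq_zero h3)
    omega
  · rw [h2 (not_le.1 h)] at hm
    simp at hm

theorem mem_varSpan_freePiece {L : List σ} {n : ℕ} {deg : Fin n → ℕ} {j : ℕ}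
    {f : Fin n → MvPolynomial σ k} (hf : f ∈ freePiece k σ deg (j + 1))
    (hL : ∀ e, ∀ m ∈ (f e).support, ∃ s ∈ L, m s ≠ 0) : f ∈ varSpan L (freePiece k σ deg j) := by
  classical
  rw [← Finset.univ_sum_single f]
  exact Submodule.sum_mem _ fun e _ =>
    single_mem_varSpan (fun m hm => support_degree_of_mem_freePiece hf e hm) (hL e)

/-- The variables form a regular sequence on a free module. -/
theorem mem_varSpan_of_X_smul_mem {s : σ} {L : List σ} (hs : s ∉ L) {n : ℕ} {deg : Fin n → ℕ}
    {i j : ℕ} {f : Fin n → MvPolynomial σ k} (hf : f ∈ freePiece k σ deg (j + 1))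
    (h : (X s : MvPolynomial σ k) • f ∈ varSpan L (freePiece k σ deg i)) :
    f ∈ varSpan L (freePiece k σ deg j) := by
  refine mem_varSpan_freePiece hf fun e m hm => ?_
  by_contra! hL
  refine mem_support_iff.1 hm ?_
  have := coeff_eq_zero_of_mem_varSpan h e (m := Finsupp.single s 1 + m) fun t ht => by
    have : s ≠ t := fun h => hs (h ▸ ht)
    simp [this, hL t ht]
  simpa [coeff_X_mul] using this

theorem freePiece_succ_le_varSpan {L : List σ} (hL : ∀ s, s ∈ L) {n : ℕ} {deg : Fin n → ℕ} {j : ℕ}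
    (hdeg : ∀ e, deg e ≠ j + 1) : freePiece k σ deg (j + 1) ≤ varSpan L (freePiece k σ deg j) := by
  refine fun f hf => mem_varSpan_freePiece hf fun e m hm => ?_
  by_contra! h
  have h0 : m = 0 := Finsupp.ext fun s => h s (hL s)
  have := support_degree_of_mem_freePiece hf e hm
  simp only [h0, map_zero, add_zero] at this
  exact hdeg e this

variable {n : ℕ} {deg : Fin n → ℕ}

theorem map_varSpan (φ : (Fin n → MvPolynomial σ k) →ₗ[MvPolynomial σ k] M) (L : List σ)
    (P : Submodule k (Fin n → MvPolynomial σ k)) :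
    (varSpan L P).map (φ.restrictScalars k) = varSpan L (P.map (φ.restrictScalars k)) := by
  induction L with
  | nil => exact Submodule.map_bot _
  | cons s L ih =>
    simp only [varSpan, Submodule.map_sup, ih, ← Submodule.map_comp]
    congr 2
    ext
    simp

/-- The graded pieces of a submodule of a graded free module. -/
noncomputable def syzygyPiece (deg : Fin n → ℕ)
    (K : Submodule (MvPolynomial σ k) (Fin n → MvPolynomial σ k)) (j : ℕ) :
    Submodule k (Fin n → MvPolynomial σ k) :=
  freePiece k σ deg j ⊓ K.restrictScalars k

variable {φ : (Fin n → MvPolynomial σ k) →ₗ[MvPolynomial σ k] M} {𝒩 : ℕ → Submodule k M}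

/-- This is the vanishing of `Tor₁` against a regular sequence: with `K` the kernel, `(L)F ∩ K =
(L)K` in the degrees where `L` is regular on the image. Both bounds on the regularity use it. -/
theorem mem_varSpan_syzygyPiece
    (hφ : ∀ j, (freePiece k σ deg j).map (φ.restrictScalars k) = 𝒩 j) {L : List σ} {c : ℕ}
    (hL : RegularFrom L c 𝒩) {j : ℕ} (hj : c ≤ j) {u : Fin n → MvPolynomial σ k}
    (hu : u ∈ varSpan L (freePiece k σ deg (j + 1))) (hu0 : φ u = 0) :
    u ∈ varSpan L (syzygyPiece deg (LinearMap.ker φ) (j + 1)) := by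
  induction L generalizing u with
  | nil => exact hu
  | cons s L ih =>
    obtain ⟨w, hw, y, hy, rfl⟩ := mem_varSpan_cons.1 hu
    have hy' : φ y ∈ varSpan L (𝒩 (j + 1)) := by
      rw [← hφ, ← map_varSpan]
      exact ⟨y, hy, rfl⟩
    have h1 : φ w ∈ varSpan L (𝒩 j) := by
      refine hL.1 j hj (φ w) (hφ (j + 1) ▸ ⟨w, hw, rfl⟩) ?_
      rw [map_add, map_smul] at hu0
      rw [eq_neg_of_add_eq_zero_left hu0]
      exact neg_mem hy'
    rw [← hφ, ← map_varSpan] at h1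
    obtain ⟨v, hv, hvw⟩ := h1
    have hvw : φ v = φ w := hvw
    have hv' : v ∈ freePiece k σ deg (j + 1) :=
      varSpan_le_iff.2 (fun s _ f hf => X_smul_mem_freePiece s hf) hv
    have h2 := ih hL.2 (u := (X s : MvPolynomial σ k) • v + y)
      (add_mem (smul_mem_varSpan s (fun f hf => X_smul_mem_freePiece s hf) hv) hy)
      (by rw [map_add, map_smul, hvw, ← map_smul, ← map_add, hu0])
    -- The coefficient `w` of `X s` is corrected by `v ∈ (L)F` with the same image, so that it
    -- becomes a syzygy; the error `X s • v` is absorbed into the part handled by induction.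
    refine mem_varSpan_cons.2 ⟨w - v, ⟨sub_mem hw hv', ?_⟩, _, h2, ?_⟩
    · simp [hvw]
    · rw [smul_sub]
      abel

theorem RegularFrom.syzygy_cons
    (hφ : ∀ j, (freePiece k σ deg j).map (φ.restrictScalars k) = 𝒩 j) {L : List σ} {c : ℕ}
    (hL : RegularFrom L c 𝒩) {s : σ} (hs : s ∉ L) {j : ℕ} (hj : c + 1 ≤ j)
    {z : Fin n → MvPolynomial σ k} (hz : z ∈ syzygyPiece deg (LinearMap.ker φ) (j + 1))
    (h : (X s : MvPolynomial σ k) • z ∈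
      varSpan L (syzygyPiece deg (LinearMap.ker φ) (j + 1))) :
    z ∈ varSpan L (syzygyPiece deg (LinearMap.ker φ) j) := by
  obtain ⟨j, rfl⟩ := Nat.exists_eq_add_of_le' (Nat.one_le_of_lt hj)
  exact mem_varSpan_syzygyPiece hφ hL (by omega)
    (mem_varSpan_of_X_smul_mem hs hz.1 (varSpan_mono inf_le_left h)) hz.2

theorem RegularFrom.syzygy
    (hφ : ∀ j, (freePiece k σ deg j).map (φ.restrictScalars k) = 𝒩 j) {L : List σ} {c : ℕ}
    (hL : RegularFrom L c 𝒩) (hnd : L.Nodup) :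
    RegularFrom L (c + 1) (syzygyPiece deg (LinearMap.ker φ)) := by
  induction L with
  | nil => trivial
  | cons s L ih =>
    rw [List.nodup_cons] at hnd
    exact ⟨fun j hj z hz h => hL.2.syzygy_cons hφ hnd.1 hj hz h, ih hL.2 hnd.2⟩

/-- Nakayama: a basis element of larger degree would differ by a syzygy from an element of the
submodule generated by the variables, and that syzygy would have a unit entry. -/
theorem degree_le_of_generated
    (hφ : ∀ j, (freePiece k σ deg j).map (φ.restrictScalars k) = 𝒩 j)
    (hmin : ∀ z ∈ LinearMap.ker φ, ∀ e, constantCoeff (z e) = 0) {L : List σ} {c : ℕ}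
    (hgen : ∀ j, c ≤ j → 𝒩 (j + 1) ≤ varSpan L (𝒩 j)) (e : Fin n) : deg e ≤ c := by
  by_contra! h
  obtain ⟨j, hj⟩ := Nat.exists_eq_add_of_le' (Nat.one_le_of_lt h)
  have h1 : φ (Pi.single e 1) ∈ varSpan L (𝒩 j) := by
    refine hgen j (by omega) ?_
    rw [← hφ, ← hj]
    exact ⟨_, single_mem_freePiece deg e, rfl⟩
  rw [← hφ, ← map_varSpan] at h1
  obtain ⟨v, hv, hv'⟩ := h1
  have h2 := hmin (v - Pi.single e 1) (by simpa [sub_eq_zero] using hv') e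
  have h3 := coeff_eq_zero_of_mem_varSpan hv e (m := 0) (by simp)
  rw [← constantCoeff_eq] at h3
  simp [h3] at h2

/-- Above the degrees of the basis every element of the free module has entries without constant
term, so `(L)F ∩ K = (L)K` applies with `L` consisting of all variables. -/
theorem syzygyPiece_succ_le_varSpan
    (hφ : ∀ j, (freePiece k σ deg j).map (φ.restrictScalars k) = 𝒩 j) {L : List σ} {c : ℕ}
    (hL : RegularFrom L c 𝒩) (hfull : ∀ s, s ∈ L) (hdeg : ∀ e, deg e ≤ c) {j : ℕ}
    (hj : c + 1 ≤ j) : syzygyPiece deg (LinearMap.ker φ) (j + 1) ≤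
      varSpan L (syzygyPiece deg (LinearMap.ker φ) j) := by
  intro z hz
  have h := freePiece_succ_le_varSpan hfull (fun e => (by have := hdeg e; omega)) hz.1
  obtain ⟨j, rfl⟩ := Nat.exists_eq_add_of_le' (Nat.one_le_of_lt hj)
  exact mem_varSpan_syzygyPiece hφ hL (by omega) h hz.2

/-- A socle element in degree `j + 1` modulo the variables in `L`. -/
def HasSocle (L : List σ) (j : ℕ) (𝒩 : ℕ → Submodule k M) : Prop :=
  ∃ x ∈ 𝒩 (j + 1), x ∉ varSpan L (𝒩 j) ∧
    ∀ s, (X s : MvPolynomial σ k) • x ∈ varSpan L (𝒩 (j + 1))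

/-- A connecting map made explicit: if `x = φ f` and `X s • x = φ (g s)` with `g s ∈ (L)F`, then `z
s = X s • f - g s` is a syzygy, and `z t` is the new socle element. -/
theorem HasSocle.syzygy
    (hφ : ∀ j, (freePiece k σ deg j).map (φ.restrictScalars k) = 𝒩 j) {L : List σ} {c j : ℕ}
    (hL : RegularFrom L c 𝒩) (hj : c ≤ j) {t : σ} (ht : t ∉ L) (h : HasSocle L j 𝒩) :
    HasSocle (t :: L) (j + 1) (syzygyPiece deg (LinearMap.ker φ)) := by
  obtain ⟨x, hx, hxL, hxs⟩ := h
  rw [← hφ] at hx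
  obtain ⟨f, hf, rfl⟩ := hx
  change φ f ∉ _ at hxL
  have key : ∀ s, ∃ g ∈ varSpan L (freePiece k σ deg (j + 1)),
      (X s : MvPolynomial σ k) • f - g ∈ syzygyPiece deg (LinearMap.ker φ) (j + 1 + 1) := by
    intro s
    have := hxs s
    rw [← hφ, ← map_varSpan] at this
    obtain ⟨g, hg, hg'⟩ := this
    change φ g = X s • φ f at hg'
    refine ⟨g, hg, sub_mem (X_smul_mem_freePiece s hf) ?_, ?_⟩
    · exact varSpan_le_iff.2 (fun s _ f hf => X_smul_mem_freePiece s hf) hg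
    · simp [hg']
  choose g hg hz using key
  refine ⟨_, hz t, fun h => ?_, fun s => ?_⟩
  · obtain ⟨w, hw, y, hy, hwy⟩ := mem_varSpan_cons.1 h
    -- If `z t = X t • w + y` with `w` a syzygy and `y ∈ (L)K`, cancelling `X t` puts `f - w` into
    -- `(L)F`, and then `φ f` would already vanish modulo `L`.
    have h1 : (X t : MvPolynomial σ k) • (f - w) ∈ varSpan L (freePiece k σ deg (j + 1)) := by
      have : (X t : MvPolynomial σ k) • (f - w) = g t + y := by
        rw [smul_sub, ← sub_eq_zero, ← sub_eq_zero.2 hwy.symm]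
        abel
      rw [this]
      exact add_mem (hg t) (varSpan_mono inf_le_left hy)
    have h2 := mem_varSpan_of_X_smul_mem ht (sub_mem hf hw.1) h1
    refine hxL ?_
    rw [← hφ, ← map_varSpan]
    refine ⟨_, h2, ?_⟩
    have : φ w = 0 := hw.2
    simp [this]
  -- This is the Koszul relation `X s • z t - X t • z s`: a syzygy lying in `(L)F`, hence in `(L)K`.
  · have h1 : (X t : MvPolynomial σ k) • g s - (X s : MvPolynomial σ k) • g t ∈
        varSpan L (freePiece k σ deg (j + 1 + 1)) :=
      sub_mem (smul_mem_varSpan t (fun f hf => X_smul_mem_freePiece t hf) (hg s))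
        (smul_mem_varSpan s (fun f hf => X_smul_mem_freePiece s hf) (hg t))
    have e1 : (X s : MvPolynomial σ k) • φ f = φ (g s) := by
      simpa [sub_eq_zero] using (hz s).2
    have e2 : (X t : MvPolynomial σ k) • φ f = φ (g t) := by
      simpa [sub_eq_zero] using (hz t).2
    have h2 := mem_varSpan_syzygyPiece hφ hL (by omega) h1
      (by rw [map_sub, map_smul, map_smul, ← e1, ← e2, smul_comm, sub_self])
    refine mem_varSpan_cons.2 ⟨_, hz s, _, h2, ?_⟩
    simp only [smul_sub]
    rw [smul_comm (X s : MvPolynomial σ k) (X t : MvPolynomial σ k) f]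
    abel

theorem HasSocle.exists_degree_eq
    (hφ : ∀ j, (freePiece k σ deg j).map (φ.restrictScalars k) = 𝒩 j) {L : List σ}
    (hfull : ∀ s, s ∈ L) {j : ℕ} (h : HasSocle L j 𝒩) : ∃ e, deg e = j + 1 := by
  by_contra! hdeg
  obtain ⟨x, hx, hxL, -⟩ := h
  rw [← hφ] at hx hxL
  rw [← map_varSpan] at hxL
  exact hxL (Submodule.map_mono (freePiece_succ_le_varSpan hfull hdeg) hx)

end GradedSyzygies

/-! ### Existence of minimal graded free resolutions -/

section MinimalResolutions

open MvPolynomial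

variable {k σ M : Type*} [Field k] [AddCommGroup M] [Module k M] [Module (MvPolynomial σ k) M]
  [IsScalarTower k (MvPolynomial σ k) M]

variable (σ) in
/-- The pieces `𝒩 j`, with the projections `π j` onto them, are a grading of the module `M` over
the standard graded polynomial ring. -/
structure IsGrading (𝒩 : ℕ → Submodule k M) (π : ℕ → M →ₗ[k] M) : Prop where
  proj_mem : ∀ j x, π j x ∈ 𝒩 j
  proj_eq_self : ∀ j, ∀ x ∈ 𝒩 j, π j x = x
  proj_eq_zero : ∀ i j, i ≠ j → ∀ x ∈ 𝒩 i, π j x = 0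
  eq_sum : ∀ x, ∃ N, x = ∑ j ∈ Finset.range N, π j x
  smul_mem : ∀ i m (p : MvPolynomial σ k), p.IsHomogeneous m → ∀ x ∈ 𝒩 i, p • x ∈ 𝒩 (i + m)

/-- The projection of a graded free module onto its degree `j` piece. -/
noncomputable def freeProj (k σ : Type*) [Field k] {n : ℕ} (deg : Fin n → ℕ) (j : ℕ) :
    (Fin n → MvPolynomial σ k) →ₗ[k] (Fin n → MvPolynomial σ k) :=
  LinearMap.pi fun e =>
    if deg e ≤ j then (homogeneousComponent (j - deg e)).comp (LinearMap.proj e) else 0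

theorem coeff_freeProj {n : ℕ} (deg : Fin n → ℕ) (j : ℕ) (f : Fin n → MvPolynomial σ k)
    (e : Fin n) (m : σ →₀ ℕ) :
    coeff m (freeProj k σ deg j f e) = if j = deg e + m.degree then coeff m (f e) else 0 := by
  rw [freeProj, LinearMap.pi_apply]
  split_ifs with h1 h2 h2
  · simp only [LinearMap.comp_apply, LinearMap.proj_apply, coeff_homogeneousComponent]
    rw [if_pos (by omega)]
  · simp only [LinearMap.comp_apply, LinearMap.proj_apply, coeff_homogeneousComponent]
    rw [if_neg (by omega)]
  · omega
  · simp

theorem isGrading_freePiece {n : ℕ} (deg : Fin n → ℕ) :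
    IsGrading σ (freePiece k σ deg) (freeProj k σ deg) where
  proj_mem j f := by
    refine mem_freePiece.2 fun e => ⟨fun h => ?_, fun h => ?_⟩
    · simp only [freeProj, LinearMap.pi_apply, if_pos h]
      exact homogeneousComponent_isHomogeneous _ _
    · simp [freeProj, not_le.2 h]
  proj_eq_self j f hf := by
    funext e
    ext m
    rw [coeff_freeProj]
    split_ifs with h
    · rfl
    · by_contra h'
      exact h (support_degree_of_mem_freePiece hf e (mem_support_iff.2 (Ne.symm h'))).symm
  proj_eq_zero i j hij f hf := by
    funext e
    ext m
    rw [coeff_freeProj]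
    split_ifs with h
    · by_contra h'
      exact hij ((support_degree_of_mem_freePiece hf e (mem_support_iff.2 h')).symm.trans h.symm)
    · rfl
  eq_sum f := by
    refine ⟨(Finset.univ.sup fun e => deg e + (f e).totalDegree) + 1, ?_⟩
    funext e
    ext m
    rw [Finset.sum_apply, coeff_sum]
    simp only [coeff_freeProj, Finset.sum_ite_eq', Finset.mem_range]
    split_ifs with h
    · rfl
    · by_contra h'
      refine h (Nat.lt_succ_of_le (le_trans ?_
        (Finset.le_sup (f := fun e => deg e + (f e).totalDegree) (Finset.mem_univ e))))
      have := le_totalDegree (mem_support_iff.2 h')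
      have h2 : m.degree = m.sum fun _ e => e := rfl
      simp only [h2]
      omega
  smul_mem _ _ _ hp _ hf := smul_mem_freePiece hp hf

variable {𝒩 : ℕ → Submodule k M} {π : ℕ → M →ₗ[k] M}

section Maps

variable {n : ℕ} {deg : Fin n → ℕ}
  {φ : (Fin n → MvPolynomial σ k) →ₗ[MvPolynomial σ k] M}

theorem IsGrading.map_mem (h𝒩 : IsGrading σ 𝒩 π) (hφ : ∀ e, φ (Pi.single e 1) ∈ 𝒩 (deg e)) {j : ℕ}
    {f : Fin n → MvPolynomial σ k} (hf : f ∈ freePiece k σ deg j) : φ f ∈ 𝒩 j := by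
  rw [← Finset.univ_sum_single f, map_sum]
  refine Submodule.sum_mem _ fun e _ => ?_
  have h1 : (Pi.single e (f e) : Fin n → MvPolynomial σ k) = f e • Pi.single e 1 := by
    rw [← Pi.single_smul, smul_eq_mul, mul_one]
  rw [h1, map_smul]
  obtain ⟨h2, h3⟩ := mem_freePiece.1 hf e
  by_cases h : deg e ≤ j
  · have := h𝒩.smul_mem _ _ _ (h2 h) _ (hφ e)
    rwa [Nat.add_sub_cancel' h] at this
  · rw [h3 (not_le.1 h), zero_smul]
    exact zero_mem _

theorem IsGrading.map_freeProj (h𝒩 : IsGrading σ 𝒩 π) (hφ : ∀ e, φ (Pi.single e 1) ∈ 𝒩 (deg e))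
    (j : ℕ) (f : Fin n → MvPolynomial σ k) : φ (freeProj k σ deg j f) = π j (φ f) := by
  have hF := isGrading_freePiece (k := k) (σ := σ) deg
  obtain ⟨N, hN⟩ := hF.eq_sum f
  conv_rhs => rw [hN]
  conv_lhs => rw [hN]
  simp only [map_sum]
  refine Finset.sum_congr rfl fun i _ => ?_
  have h1 := hF.proj_mem i f
  have h2 := h𝒩.map_mem hφ h1
  rcases eq_or_ne i j with rfl | hij
  · rw [hF.proj_eq_self _ _ h1, h𝒩.proj_eq_self _ _ h2]
  · rw [hF.proj_eq_zero _ _ hij _ h1, h𝒩.proj_eq_zero _ _ hij _ h2, map_zero]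

theorem IsGrading.map_freePiece (h𝒩 : IsGrading σ 𝒩 π)
    (hφ : ∀ e, φ (Pi.single e 1) ∈ 𝒩 (deg e)) (j : ℕ) :
    (freePiece k σ deg j).map (φ.restrictScalars k) =
      𝒩 j ⊓ (LinearMap.range φ).restrictScalars k := by
  refine le_antisymm ?_ ?_
  · rintro _ ⟨f, hf, rfl⟩
    exact ⟨h𝒩.map_mem hφ hf, f, rfl⟩
  · rintro _ ⟨hx, f, rfl⟩
    refine ⟨_, (isGrading_freePiece deg).proj_mem j f, ?_⟩
    exact (h𝒩.map_freeProj hφ j f).trans (h𝒩.proj_eq_self _ _ hx)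

theorem IsGrading.freeProj_mem_ker (h𝒩 : IsGrading σ 𝒩 π)
    (hφ : ∀ e, φ (Pi.single e 1) ∈ 𝒩 (deg e)) (j : ℕ) {f : Fin n → MvPolynomial σ k}
    (hf : f ∈ LinearMap.ker φ) : freeProj k σ deg j f ∈ LinearMap.ker φ := by
  rw [LinearMap.mem_ker] at hf ⊢
  rw [h𝒩.map_freeProj hφ, hf, map_zero]

end Maps

theorem IsGrading.exists_generators (h𝒩 : IsGrading σ 𝒩 π)
    {K : Submodule (MvPolynomial σ k) M} (hK : ∀ j, ∀ x ∈ K, π j x ∈ K) (hfg : K.FG) :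
    ∃ (n : ℕ) (deg : Fin n → ℕ) (g : Fin n → M), (∀ e, g e ∈ 𝒩 (deg e)) ∧
      Submodule.span (MvPolynomial σ k) (Set.range g) = K := by
  classical
  obtain ⟨s, hs⟩ := hfg
  choose N hN using h𝒩.eq_sum
  let T : Finset (Σ _ : M, ℕ) := s.sigma fun x => Finset.range (N x)
  let q := T.equivFin.symm
  refine ⟨T.card, fun e => (q e).1.2, fun e => π (q e).1.2 (q e).1.1,
    fun e => h𝒩.proj_mem _ _, le_antisymm ?_ ?_⟩
  · rw [Submodule.span_le]
    rintro _ ⟨e, rfl⟩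
    refine hK _ _ (hs ▸ Submodule.subset_span ?_)
    exact (Finset.mem_sigma.1 (q e).2).1
  · rw [← hs, Submodule.span_le]
    intro x hx
    rw [SetLike.mem_coe, hN x]
    refine Submodule.sum_mem _ fun j hj => Submodule.subset_span ?_
    refine ⟨q.symm ⟨⟨x, j⟩, Finset.mem_sigma.2 ⟨hx, hj⟩⟩, ?_⟩
    simp

/-- A graded submodule is the image of a graded free module, with kernel in the submodule
generated by the variables. -/
theorem IsGrading.exists_minimal_cover (h𝒩 : IsGrading σ 𝒩 π)
    {K : Submodule (MvPolynomial σ k) M} (hK : ∀ j, ∀ x ∈ K, π j x ∈ K) (hfg : K.FG) :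
    ∃ (n : ℕ) (deg : Fin n → ℕ) (φ : (Fin n → MvPolynomial σ k) →ₗ[MvPolynomial σ k] M),
      (∀ e, φ (Pi.single e 1) ∈ 𝒩 (deg e)) ∧ LinearMap.range φ = K ∧
      ∀ z ∈ LinearMap.ker φ, ∀ e, constantCoeff (z e) = 0 := by
  classical
  have hex := h𝒩.exists_generators hK hfg
  -- Minimality comes from a homogeneous generating family with the fewest members.
  obtain ⟨deg, g, hg, hgK⟩ := Nat.find_spec hex
  have hmin := fun m (hm : m < Nat.find hex) => Nat.find_min hex hm
  generalize Nat.find hex = n at *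
  let φ := Fintype.linearCombination (MvPolynomial σ k) g
  have hφs : ∀ e, φ (Pi.single e 1) = g e := fun e => by
    simp [φ, Fintype.linearCombination_apply_single]
  have hφ : ∀ e, φ (Pi.single e 1) ∈ 𝒩 (deg e) := fun e => by
    rw [hφs]
    exact hg e
  refine ⟨n, deg, φ, hφ, (Fintype.range_linearCombination _ _).trans hgK, fun z hz e => ?_⟩
  by_contra hc
  -- The component of `z` in degree `deg e` is again a relation, and its entry at `e` is exactly the
  -- nonzero constant; it therefore expresses `g e` through the other generators.
  have hz' := h𝒩.freeProj_mem_ker hφ (deg e) hz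
  have he : freeProj k σ deg (deg e) z e = C (constantCoeff (z e)) := by
    simp [freeProj, homogeneousComponent_zero, constantCoeff_eq]
  generalize freeProj k σ deg (deg e) z = y at hz' he
  cases n with
  | zero => exact e.elim0
  | succ n =>
    refine hmin n n.lt_succ_self ⟨deg ∘ e.succAbove, g ∘ e.succAbove, fun f => hg _, ?_⟩
    refine le_antisymm (hgK ▸ Submodule.span_mono (Set.range_comp_subset_range _ _)) ?_
    rw [← hgK, Submodule.span_le]
    have hrest : ∀ f, g (e.succAbove f) ∈
        Submodule.span (MvPolynomial σ k) (Set.range (g ∘ e.succAbove)) :=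
      fun f => Submodule.subset_span ⟨f, rfl⟩
    rintro _ ⟨f, rfl⟩
    rcases Fin.eq_self_or_eq_succAbove e f with rfl | ⟨f, rfl⟩
    · have h1 : ∑ i, y i • g i = 0 := by
        simpa [φ, Fintype.linearCombination_apply] using hz'
      rw [Fin.sum_univ_succAbove _ f, he] at h1
      have h2 : (C (constantCoeff (z f)) : MvPolynomial σ k) • g f ∈
          Submodule.span (MvPolynomial σ k) (Set.range (g ∘ f.succAbove)) := by
        rw [eq_neg_of_add_eq_zero_left h1]
        exact neg_mem (Submodule.sum_mem _ fun i _ => Submodule.smul_mem _ _ (hrest i))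
      have h3 := Submodule.smul_mem _ (C (constantCoeff (z f))⁻¹ : MvPolynomial σ k) h2
      rwa [smul_smul, ← C_mul, inv_mul_cancel₀ hc, C_1, one_smul] at h3
    · exact hrest f

/-- A graded submodule of a graded free module, contained in the submodule generated by the
variables. -/
structure GradedSyzygy (k σ : Type*) [Field k] where
  rank : ℕ
  deg : Fin rank → ℕ
  module : Submodule (MvPolynomial σ k) (Fin rank → MvPolynomial σ k)
  freeProj_mem : ∀ j, ∀ x ∈ module, freeProj k σ deg j x ∈ module
  minimal : ∀ z ∈ module, ∀ e, constantCoeff (z e) = 0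

theorem GradedSyzygy.exists_next [Finite σ] (Z : GradedSyzygy k σ) :
    ∃ (Z' : GradedSyzygy k σ) (φ : (Fin Z'.rank → MvPolynomial σ k) →ₗ[MvPolynomial σ k]
      (Fin Z.rank → MvPolynomial σ k)), (∀ e, φ (Pi.single e 1) ∈ freePiece k σ Z.deg (Z'.deg e)) ∧
      LinearMap.range φ = Z.module ∧ LinearMap.ker φ = Z'.module := by
  have hF := isGrading_freePiece (k := k) (σ := σ) Z.deg
  obtain ⟨n, deg, φ, h1, h2, h3⟩ := hF.exists_minimal_cover Z.freeProj_mem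
    (IsNoetherian.noetherian _)
  exact ⟨⟨n, deg, LinearMap.ker φ, fun j x hx => hF.freeProj_mem_ker h1 j hx, h3⟩, φ, h1, h2, rfl⟩

theorem IsGrading.nonempty_minimalGradedFreeResolution [Finite σ] (h𝒩 : IsGrading σ 𝒩 π)
    [Module.Finite (MvPolynomial σ k) M] :
    Nonempty (MinimalGradedFreeResolution (σ := σ) 𝒩) := by
  obtain ⟨n, deg, aug, h1, h2, h3⟩ := h𝒩.exists_minimal_cover (K := ⊤)
    (fun _ _ _ => trivial) Module.Finite.fg_top
  choose next φ hφ hrange hker using GradedSyzygy.exists_next (k := k) (σ := σ)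
  let Z₀ : GradedSyzygy k σ :=
    ⟨n, deg, LinearMap.ker aug, fun j x hx => h𝒩.freeProj_mem_ker h1 j hx, h3⟩
  let Z : ℕ → GradedSyzygy k σ := fun i => Nat.rec Z₀ (fun _ => next) i
  exact ⟨{
    rank := fun i => (Z i).rank
    deg := fun i => (Z i).deg
    aug := aug
    d := fun i => φ (Z i)
    aug_homogeneous := h1
    d_homogeneous := fun i e f => by
      obtain ⟨h4, h5⟩ := mem_freePiece.1 (hφ (Z i) e) f
      by_cases h : (Z i).deg f ≤ (next (Z i)).deg e
      · exact Or.inr ⟨_, Nat.add_sub_cancel' h, h4 h⟩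
      · exact Or.inl (h5 (not_le.1 h))
    aug_surjective := LinearMap.range_eq_top.1 h2
    exact_zero := LinearMap.exact_iff.2 (hrange Z₀).symm
    exact_succ := fun i => LinearMap.exact_iff.2 ((hker (Z i)).trans (hrange (Z (i + 1))).symm)
    minimal := fun i e f => (Z i).minimal _ (by
      rw [← hrange (Z i)]
      exact ⟨_, rfl⟩) f }⟩

/-! ### Bounds for the degrees in a minimal resolution -/

section Regularity

variable (F : MinimalGradedFreeResolution (σ := σ) 𝒩)

namespace MinimalGradedFreeResolution

theorem d_mem (i : ℕ) (e : Fin (F.rank (i + 1))) :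
    F.d i (Pi.single e 1) ∈ freePiece k σ (F.deg i) (F.deg (i + 1) e) := by
  refine mem_freePiece.2 fun f => ?_
  rcases F.d_homogeneous i e f with h | ⟨m, h1, h2⟩
  · rw [h]
    exact ⟨fun _ => isHomogeneous_zero _ _ _, fun _ => rfl⟩
  · refine ⟨fun _ => ?_, fun _ => by omega⟩
    rwa [show F.deg (i + 1) e - F.deg i f = m by omega]

theorem minimal_range (i : ℕ) {z : Fin (F.rank i) → MvPolynomial σ k}
    (hz : z ∈ LinearMap.range (F.d i)) (f : Fin (F.rank i)) : constantCoeff (z f) = 0 := by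
  classical
  obtain ⟨y, rfl⟩ := hz
  have : y = ∑ e, y e • (Pi.single e 1 : Fin (F.rank (i + 1)) → MvPolynomial σ k) := by
    conv_lhs => rw [← Finset.univ_sum_single y]
    refine Finset.sum_congr rfl fun e _ => ?_
    rw [← Pi.single_smul, smul_eq_mul, mul_one]
  rw [this, map_sum, Finset.sum_apply, map_sum]
  refine Finset.sum_eq_zero fun e _ => ?_
  rw [map_smul, Pi.smul_apply, smul_eq_mul, map_mul, F.minimal, mul_zero]

theorem ker_aug : LinearMap.ker F.aug = LinearMap.range (F.d 0) :=
  LinearMap.exact_iff.1 F.exact_zero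

theorem ker_d (i : ℕ) : LinearMap.ker (F.d i) = LinearMap.range (F.d (i + 1)) :=
  LinearMap.exact_iff.1 (F.exact_succ i)

theorem map_aug (h𝒩 : IsGrading σ 𝒩 π) (j : ℕ) :
    (freePiece k σ (F.deg 0) j).map (F.aug.restrictScalars k) = 𝒩 j := by
  rw [h𝒩.map_freePiece F.aug_homogeneous, LinearMap.range_eq_top.2 F.aug_surjective]
  exact inf_top_eq _

theorem map_d (i j : ℕ) : (freePiece k σ (F.deg (i + 1)) j).map ((F.d i).restrictScalars k) =
    syzygyPiece (F.deg i) (LinearMap.range (F.d i)) j :=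
  (isGrading_freePiece _).map_freePiece (F.d_mem i) j

/-- Induction along the resolution: regularity of all variables and generation by them both pass to
the next syzygy module with the bound raised by one. -/
theorem degree_le (h𝒩 : IsGrading σ 𝒩 π) {L : List σ} (hnd : L.Nodup) (hfull : ∀ s, s ∈ L)
    {r : ℕ} (hreg : RegularFrom L r 𝒩) (hgen : ∀ j, r ≤ j → 𝒩 (j + 1) ≤ varSpan L (𝒩 j))
    (i : ℕ) (e : Fin (F.rank i)) : F.deg i e ≤ r + i := by
  have h0 : ∀ e, F.deg 0 e ≤ r := degree_le_of_generated (F.map_aug h𝒩) (fun z hz =>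
    F.minimal_range 0 (F.ker_aug ▸ hz)) hgen
  have key : ∀ i, RegularFrom L (r + i + 1) (syzygyPiece (F.deg i) (LinearMap.range (F.d i))) ∧
      ∀ j, r + i + 1 ≤ j → syzygyPiece (F.deg i) (LinearMap.range (F.d i)) (j + 1) ≤
        varSpan L (syzygyPiece (F.deg i) (LinearMap.range (F.d i)) j) := by
    intro i
    induction i with
    | zero =>
      rw [← F.ker_aug]
      exact ⟨hreg.syzygy (F.map_aug h𝒩) hnd,
        fun j hj => syzygyPiece_succ_le_varSpan (F.map_aug h𝒩) hreg hfull h0 hj⟩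
    | succ i ih =>
      have h1 : ∀ e, F.deg (i + 1) e ≤ r + i + 1 := degree_le_of_generated (F.map_d i)
        (fun z hz => F.minimal_range (i + 1) (F.ker_d i ▸ hz)) ih.2
      rw [← F.ker_d]
      exact ⟨ih.1.syzygy (F.map_d i) hnd,
        fun j hj => syzygyPiece_succ_le_varSpan (F.map_d i) ih.1 hfull h1 hj⟩
  cases i with
  | zero => exact h0 e
  | succ i =>
    exact degree_le_of_generated (F.map_d i)
        (fun z hz => F.minimal_range (i + 1) (F.ker_d i ▸ hz)) (key i).2 e

/-- The socle element climbs the resolution while the list `[s]` is extended to the left by one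
variable per step. When the whole list is reached, a socle element is a class outside the span of
all variables, hence a minimal generator. -/
theorem exists_degree_eq (h𝒩 : IsGrading σ 𝒩 π) {L : List σ} {s : σ} (hnd : (L ++ [s]).Nodup)
    (hfull : ∀ t, t ∈ L ++ [s]) {r : ℕ} (hreg : RegularFrom [s] 0 𝒩) (hsoc : HasSocle [s] r 𝒩) :
    ∃ e : Fin (F.rank L.length), F.deg L.length e = r + 1 + L.length := by
  have key : ∀ i (t : σ) (L₁ L₂ : List σ), L ++ [s] = L₁ ++ t :: L₂ → L₂.length = i + 1 →
      RegularFrom (t :: L₂) (i + 1) (syzygyPiece (F.deg i) (LinearMap.range (F.d i))) ∧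
      HasSocle (t :: L₂) (r + i + 1) (syzygyPiece (F.deg i) (LinearMap.range (F.d i))) := by
    intro i
    induction i with
    | zero =>
      intro t L₁ L₂ hL hlen
      obtain ⟨u, rfl⟩ := List.length_eq_one_iff.1 hlen
      rw [show L₁ ++ t :: [u] = (L₁ ++ [t]) ++ [u] by simp] at hL
      obtain ⟨rfl, hu⟩ := List.append_inj' hL rfl
      obtain rfl : s = u := by simpa using hu
      have ht : t ∉ [s] := by
        intro h
        simp only [List.append_assoc, List.nodup_append] at hnd
        simp_all
      rw [← F.ker_aug]
      exact ⟨⟨fun j hj z hz h => hreg.syzygy_cons (F.map_aug h𝒩) ht hj hz h,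
        hreg.syzygy (F.map_aug h𝒩) (List.nodup_singleton _)⟩,
        hsoc.syzygy (F.map_aug h𝒩) hreg (Nat.zero_le _) ht⟩
    | succ i ih =>
      intro t L₁ L₂ hL hlen
      obtain ⟨u, L₂, rfl⟩ := List.exists_cons_of_length_eq_add_one hlen
      obtain ⟨h1, h2⟩ := ih u (L₁ ++ [t]) L₂ (by simpa using hL) (by simpa using hlen)
      rw [hL, List.nodup_append] at hnd
      obtain ⟨ht, hnd'⟩ := List.nodup_cons.1 hnd.2.1
      rw [← F.ker_d]
      exact ⟨⟨fun j hj z hz h => h1.syzygy_cons (F.map_d i) ht hj hz h,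
        h1.syzygy (F.map_d i) hnd'⟩, h2.syzygy (F.map_d i) h1 (by omega) ht⟩
  rcases L with _ | ⟨t, L⟩
  · exact hsoc.exists_degree_eq (F.map_aug h𝒩) hfull
  · obtain ⟨e, he⟩ := (key L.length t [] (L ++ [s]) rfl (by simp)).2.exists_degree_eq
      (F.map_d L.length) hfull
    exact ⟨e, he.trans (by simp; omega)⟩

end MinimalGradedFreeResolution

theorem IsGrading.hasRegularity [Finite σ] [Module.Finite (MvPolynomial σ k) M]
    (h𝒩 : IsGrading σ 𝒩 π) {L : List σ} {s : σ} (hnd : (L ++ [s]).Nodup)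
    (hfull : ∀ t, t ∈ L ++ [s]) {r : ℕ} (hreg : RegularFrom (L ++ [s]) (r + 1) 𝒩)
    (hgen : ∀ j, r + 1 ≤ j → 𝒩 (j + 1) ≤ varSpan (L ++ [s]) (𝒩 j))
    (hreg₀ : RegularFrom [s] 0 𝒩) (hsoc : HasSocle [s] r 𝒩) :
    HasRegularity (σ := σ) 𝒩 (r + 1 : ℕ) := by
  refine ⟨h𝒩.nonempty_minimalGradedFreeResolution, fun F => ⟨?_, ?_⟩⟩
  · obtain ⟨e, he⟩ := F.exists_degree_eq h𝒩 hnd hfull hreg₀ hsoc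
    refine ⟨L.length, e, ?_⟩
    rw [he]
    push_cast
    ring
  · rintro _ ⟨i, e, rfl⟩
    have := F.degree_le h𝒩 hnd hfull hreg hgen i e
    omega

end Regularity

end MinimalResolutions

/-! ### Sumsets of two intervals and the conductor -/

section SumsetIntervals

/-- For `E = [0, a] ∪ [b, d]`, the number `α` is a sum of `n` elements of `E`: of `i` elements of
`[0, a]` and `j` elements of `[b, d]`. -/
def IsIntervalSum (a b d n α : ℕ) : Prop :=
  ∃ i j, i + j = n ∧ j * b ≤ α ∧ α ≤ i * a + j * d

variable {a b d : ℕ}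

theorem IsIntervalSum.add {m n α β : ℕ} (h : IsIntervalSum a b d m α)
    (h' : IsIntervalSum a b d n β) : IsIntervalSum a b d (m + n) (α + β) := by
  obtain ⟨i, j, rfl, h1, h2⟩ := h
  obtain ⟨i', j', rfl, h3, h4⟩ := h'
  exact ⟨i + i', j + j', by ring, by linarith, by linarith⟩

theorem isIntervalSum_zero : IsIntervalSum a b d 0 0 := ⟨0, 0, by simp⟩

theorem isIntervalSum_one {α : ℕ} (h : α ∈ Set.Icc 0 a ∪ Set.Icc b d) :
    IsIntervalSum a b d 1 α := by
  rcases h with h | h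
  · exact ⟨1, 0, rfl, by simp, by simpa using h.2⟩
  · exact ⟨0, 1, rfl, by simpa using h.1, by simpa using h.2⟩

theorem IsIntervalSum.le (had : a ≤ d) {n α : ℕ} (h : IsIntervalSum a b d n α) : α ≤ n * d := by
  obtain ⟨i, j, rfl, -, h2⟩ := h
  nlinarith [Nat.mul_le_mul_left i had]

theorem IsIntervalSum.exists_add (hbd : b ≤ d) {n α : ℕ} (h : IsIntervalSum a b d (n + 1) α) :
    ∃ β ∈ Set.Icc 0 a ∪ Set.Icc b d, ∃ γ, IsIntervalSum a b d n γ ∧ α = β + γ := by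
  obtain ⟨i, j, hij, h1, h2⟩ := h
  rcases j with _ | j
  · obtain ⟨i, rfl⟩ : ∃ i', i = i' + 1 := ⟨n, by omega⟩
    have h3 : (i + 1) * a = i * a + a := by ring
    exact ⟨min a α, Or.inl ⟨Nat.zero_le _, min_le_left _ _⟩, α - min a α,
      ⟨i, 0, by omega, by omega, by omega⟩, by omega⟩
  · have h3 : (j + 1) * b = j * b + b := by ring
    have h4 : (j + 1) * d = j * d + d := by ring
    have h5 : j * b ≤ j * d := Nat.mul_le_mul_left j hbd
    exact ⟨min d (α - j * b), Or.inr ⟨by omega, by omega⟩, α - min d (α - j * b),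
      ⟨i, j, by omega, by omega, by omega⟩, by omega⟩

/-- The hypothesis says that the intervals for `j` and `j + 1` overlap or are adjacent; `α` is
caught by the interval of the largest `j` with `j * b ≤ α`. -/
theorem isIntervalSum_of_no_gap {n α : ℕ}
    (h : ∀ i j, i + j + 1 = n → (j + 1) * b ≤ (i + 1) * a + j * d + 1) (hα : α ≤ n * d) :
    IsIntervalSum a b d n α := by
  have h0 : ∃ j, j ≤ n ∧ j * b ≤ α := ⟨0, by simp⟩
  obtain ⟨j, hj, hmax⟩ : ∃ j, (j ≤ n ∧ j * b ≤ α) ∧ ∀ i, i ≤ n ∧ i * b ≤ α → i ≤ j :=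
    ⟨Nat.findGreatest (fun j => j ≤ n ∧ j * b ≤ α) n,
      Nat.findGreatest_spec (P := fun j => j ≤ n ∧ j * b ≤ α) (Nat.zero_le n) (by simp),
      fun i hi => Nat.le_findGreatest hi.1 hi⟩
  rcases hj.1.eq_or_lt with rfl | hlt
  · exact ⟨0, j, by simp, hj.2, by simpa using hα⟩
  · obtain ⟨i, rfl⟩ := Nat.exists_eq_add_of_lt hlt
    refine ⟨i + 1, j, by omega, hj.2, ?_⟩
    have h1 := h i j (by omega)
    have h2 : ¬ (j + 1) * b ≤ α := fun h2 => by
      have := hmax (j + 1) ⟨by omega, h2⟩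
      omega
    omega

/-- The number from which on the multiples of `E = [0, a] ∪ [b, d]` have no gaps. -/
theorem exists_conductor (ha : 1 ≤ a) (hab : a + 2 ≤ b) (hbd : b < d) :
    ∃ r : ℕ, (r : ℤ) = (if (a : ℤ) ≤ d - b then ⌈((b : ℚ) - 1) / a⌉
        else ⌈((d : ℚ) - a - 1) / (d - b)⌉) ∧ 2 ≤ r ∧
      (∀ n, r ≤ n → ∀ α ≤ n * d, IsIntervalSum a b d n α) ∧
      ∀ n < r, ∃ α, IsIntervalSum a b d (n + 1) α ∧
        (d ≤ α → ¬ IsIntervalSum a b d n (α - d)) ∧ (α ≤ n * d → ¬ IsIntervalSum a b d n α) := by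
  obtain ⟨c, rfl⟩ := Nat.exists_eq_add_of_lt hbd
  obtain ⟨g, rfl⟩ := Nat.exists_eq_add_of_le hab
  -- Here `d - b = c + 1`. The condition for no gap reads `b ≤ (i + 1) * a + j * (d - b) + 1`; for
  -- fixed `i + j` it is tightest at `j = 0` if `a ≤ d - b`, and at `i = 0` otherwise. These
  -- extremes give the two formulas.
  by_cases hc : a ≤ c + 1
  · have ha' : (0 : ℚ) < a := by exact_mod_cast ha
    have hle : ∀ n : ℕ, ⌈((a + 2 + g : ℕ) - 1 : ℚ) / a⌉₊ ≤ n ↔ a + 1 + g ≤ n * a := by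
      intro n
      rw [Nat.ceil_le, div_le_iff₀ ha', sub_le_iff_le_add]
      norm_cast
      omega
    refine ⟨⌈((a + 2 + g : ℕ) - 1 : ℚ) / a⌉₊, ?_, ?_, ?_, ?_⟩
    · rw [if_pos (by push_cast; linarith), Int.natCast_ceil_eq_ceil]
      refine div_nonneg ?_ ha'.le
      push_cast
      linarith
    · by_contra! h
      have := (hle 1).1 (by omega)
      omega
    · intro n hn α hα
      refine isIntervalSum_of_no_gap ?_ hα
      rintro i j rfl
      have := (hle _).1 hn
      nlinarith [Nat.mul_le_mul_left j hc]
    · intro n hn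
      have hn' : n * a < a + 1 + g := by
        rw [← not_le, ← hle]
        omega
      -- The first number in the gap between `n * a` and `b`; it is smaller than `d`, so subtracting
      -- `d` is not possible.
      refine ⟨n * a + 1, ⟨n + 1, 0, rfl, by simp, by nlinarith⟩, fun h => by omega, ?_⟩
      rintro - ⟨i, j, rfl, h1, h2⟩
      rcases j with _ | j
      · simp at h2
      · nlinarith
  · have hcd : (0 : ℚ) < c + 1 := by positivity
    have hle : ∀ n : ℕ, ⌈((2 + g + c : ℕ) : ℚ) / (c + 1)⌉₊ ≤ n ↔ 2 + g + c ≤ n * (c + 1) := by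
      intro n
      rw [Nat.ceil_le, div_le_iff₀ hcd]
      norm_cast
    refine ⟨⌈((2 + g + c : ℕ) : ℚ) / (c + 1)⌉₊, ?_, ?_, ?_, ?_⟩
    · rw [if_neg (by push_cast; omega), Int.natCast_ceil_eq_ceil (by positivity)]
      congr 2
      · push_cast
        ring
      · push_cast
        ring
    · by_contra! h
      have := (hle 1).1 (by omega)
      omega
    · intro n hn α hα
      refine isIntervalSum_of_no_gap ?_ hα
      rintro i j rfl
      have := (hle _).1 hn
      nlinarith [Nat.mul_le_mul_left i (not_le.1 hc).le]
    · intro n hn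
      have hn' : n * (c + 1) < 2 + g + c := by
        rw [← not_le, ← hle]
        omega
      -- This is `n * b + (d - 1)`: subtracting `d` leaves `n * b - 1`, just below the last interval
      -- of `n`-fold sums, and without subtraction it exceeds `n * d`.
      refine ⟨n * (a + 2 + g) + (a + 2 + g + c), ⟨0, n + 1, by simp, by nlinarith, by nlinarith⟩,
        fun _ => ?_, fun h => by nlinarith⟩
      rintro ⟨i, j, rfl, h1, h2⟩
      -- The subtraction would truncate for `i + j = 0`; that case is excluded because `d ≤ α` has
      -- been assumed.
      have h3 : (i + j) * (a + 2 + g) + (a + 2 + g + c) - (a + 2 + g + c + 1) + 1 =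
        (i + j) * (a + 2 + g) := by
          rcases Nat.eq_zero_or_pos (i + j) with h | h
          · simp [h] at *
          · have := Nat.le_mul_of_pos_left (a + 2 + g) h
            omega
      rcases i with _ | i
      · rw [Nat.zero_add] at *
        omega
      · nlinarith

end SumsetIntervals

/-! ### An obstruction to depth two -/

section Depth

/-- An element `h ∉ R` of an overring multiplied into `R` by a prime `p` of height at least two
is an obstruction to the Cohen-Macaulayness of `R_p`. -/
theorem not_isCohenMacaulayLocal_of_mul_mem {k B : Type*} [Field k] [CommRing B] [IsDomain B]
    [Algebra k B] (R : Subalgebra k B) (p : Ideal R) [p.IsPrime] (hp : 2 ≤ p.height) (h : B)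
    (hmul : ∀ f ∈ p, (f : B) * h ∈ R) (hnot : ∀ s ∉ p, (s : B) * h ∉ R) :
    ¬ IsCohenMacaulayLocal (Localization.AtPrime p) := by
  rintro ⟨rs, hmem, hreg, hlen⟩
  rw [IsLocalization.AtPrime.ringKrullDim_eq_height p (Localization.AtPrime p)] at hlen
  have hlen2 : 2 ≤ rs.length := by
    have : p.height = rs.length := (WithBot.coe_injective hlen).symm
    rw [this] at hp
    exact_mod_cast hp
  obtain ⟨f, rs, rfl⟩ := List.exists_cons_of_length_pos (by omega : 0 < rs.length)
  obtain ⟨g, rs, rfl⟩ := List.exists_cons_of_length_pos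
    (by simp at hlen2; omega : 0 < rs.length)
  have hf := hmem f (by simp)
  have hg := hmem g (by simp)
  obtain ⟨hfreg, hreg'⟩ :=
    (RingTheory.Sequence.isWeaklyRegular_cons_iff _ _ _).1 hreg.toIsWeaklyRegular
  have hgreg := ((RingTheory.Sequence.isWeaklyRegular_cons_iff _ _ _).1 hreg').1
  obtain ⟨f', s, rfl⟩ := IsLocalization.exists_mk'_eq p.primeCompl f
  obtain ⟨g', t, rfl⟩ := IsLocalization.exists_mk'_eq p.primeCompl g
  rw [IsLocalization.AtPrime.mk'_mem_maximal_iff _ p] at hf hg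
  let u : R := ⟨f' * h, hmul f' hf⟩
  let v : R := ⟨g' * h, hmul g' hg⟩
  -- Both sides are `f' g' h`. As `g` is regular modulo `f`, the element `u = f' h` is a multiple of
  -- `f` in the localization, which puts `h` itself there.
  have huv : g' * u = f' * v := Subtype.ext (by simp [u, v]; ring)
  have hinj : Function.Injective (algebraMap R (Localization.AtPrime p)) :=
    IsLocalization.injective _ p.primeCompl_le_nonZeroDivisors
  have h1 := mem_of_isSMulRegular_quotient_of_smul_mem hgreg
    (x := algebraMap R (Localization.AtPrime p) (t * u)) (by
      refine (Submodule.mem_smul_pointwise_iff_exists _ _ _).2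
        ⟨algebraMap _ _ (s * v), trivial, ?_⟩
      rw [smul_eq_mul, smul_eq_mul, map_mul, map_mul, ← mul_assoc, ← mul_assoc,
        IsLocalization.mk'_spec, IsLocalization.mk'_spec, ← map_mul, ← map_mul, huv])
  obtain ⟨w, -, hw⟩ := (Submodule.mem_smul_pointwise_iff_exists _ _ _).1 h1
  obtain ⟨w', q, rfl⟩ := IsLocalization.exists_mk'_eq p.primeCompl w
  -- Clearing denominators: after cancelling `f'`, an element outside `p` multiplies `h` into `R`.
  have h2 : f' * w' = (t * (s * q) : R) * u := by
    apply hinj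
    have h3 := congrArg (fun z => algebraMap R (Localization.AtPrime p) (s * q) * z) hw
    simp only [smul_eq_mul] at h3
    rw [← IsLocalization.mk'_mul, map_mul, map_mul] at h3
    have h4 := IsLocalization.mk'_spec' (Localization.AtPrime p) (f' * w') (s * q)
    rw [Submonoid.coe_mul, map_mul] at h4
    rw [h4] at h3
    rw [h3]
    simp only [map_mul]
    ring
  have hf0 : (f' : B) ≠ 0 := by
    intro h0
    obtain rfl : f' = 0 := Subtype.ext h0
    rw [IsLocalization.mk'_zero] at hfreg
    exact one_ne_zero (hfreg (show (0 : Localization.AtPrime p) • (1 : Localization.AtPrime p) =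
      (0 : Localization.AtPrime p) • 0 by simp))
  refine hnot (t * (s * q) : R) (t * (s * q)).2 ?_
  have h3 : (f' : B) * w' = f' * (((t * (s * q) : R) : B) * h) := by
    have := congrArg (Subtype.val : R → B) h2
    simp only [MulMemClass.coe_mul, u] at this
    rw [this]
    push_cast
    ring
  rw [← mul_left_cancel₀ hf0 h3]
  exact w'.2

end Depth

namespace MonomialCurve

open MvPolynomial

/-! ### Monomials of the coordinate ring -/

section Monomials

variable {k : Type*} [Field k] {a b d : ℕ} {E : Set ℕ}

theorem mono_eq_monomial (α : ℕ) :
    mono k d α = monomial (Finsupp.single 0 α + Finsupp.single 1 (d - α)) 1 := by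
  rw [mono, X_pow_eq_monomial, X_pow_eq_monomial, monomial_mul, one_mul]

theorem eq_single_add_single (m : Fin 2 →₀ ℕ) :
    m = Finsupp.single 0 (m 0) + Finsupp.single 1 (m 1) := by
  ext i
  fin_cases i <;> simp

theorem degree_fin_two (m : Fin 2 →₀ ℕ) : m.degree = m 0 + m 1 := by
  rw [Finsupp.degree_eq_sum, Fin.sum_univ_two]

theorem monomial_mem_coordRing (had : a < d) (hbd : b < d) (hE : E = Set.Icc 0 a ∪ Set.Icc b d)
    {n : ℕ} {m : Fin 2 →₀ ℕ} (hm : m 0 + m 1 = n * d) (hn : IsIntervalSum a b d n (m 0)) (c : k) :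
    monomial m c ∈ coordRing k d E := by
  suffices h : monomial m (1 : k) ∈ coordRing k d E by
    have := (coordRing k d E).smul_mem h c
    rwa [smul_monomial, smul_eq_mul, mul_one] at this
  induction n generalizing m with
  | zero =>
    obtain rfl : m = 0 := by
      rw [eq_single_add_single m]
      simp at hm
      simp [hm.1, hm.2]
    exact one_mem _
  | succ n ih =>
    obtain ⟨β, hβ, γ, hγ, hm0⟩ := hn.exists_add hbd.le
    have hβd : β ≤ d := by
      rcases hβ with h | h
      · exact h.2.trans had.le
      · exact h.2
    have hγd := hγ.le had.le
    have h1 : (n + 1) * d = n * d + d := by ring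
    have h2 : m = (Finsupp.single 0 β + Finsupp.single 1 (d - β)) +
        (Finsupp.single 0 γ + Finsupp.single 1 (n * d - γ)) := by
      ext i
      fin_cases i <;> simp <;> omega
    have h3 : monomial m (1 : k) =
        mono k d β * monomial (Finsupp.single 0 γ + Finsupp.single 1 (n * d - γ)) 1 := by
      rw [mono_eq_monomial, monomial_mul, one_mul, ← h2]
    rw [h3]
    refine mul_mem (Algebra.subset_adjoin ⟨β, hE ▸ hβ, rfl⟩) (ih ?_ ?_)
    · simp
      omega
    · simpa using hγ

theorem mem_coordRing_iff (had : a < d) (hbd : b < d) (hE : E = Set.Icc 0 a ∪ Set.Icc b d)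
    {f : MvPolynomial (Fin 2) k} : f ∈ coordRing k d E ↔
      ∀ m ∈ f.support, ∃ n, m 0 + m 1 = n * d ∧ IsIntervalSum a b d n (m 0) := by
  classical
  refine ⟨fun hf => ?_, fun h => ?_⟩
  · refine Algebra.adjoin_induction (p := fun f _ =>
      ∀ m ∈ f.support, ∃ n, m 0 + m 1 = n * d ∧ IsIntervalSum a b d n (m 0)) ?_ ?_ ?_ ?_ hf
    · rintro _ ⟨α, hα, rfl⟩ m hm
      rw [mono_eq_monomial] at hm
      obtain rfl := Finset.mem_singleton.1 (support_monomial_subset hm)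
      rw [hE] at hα
      have hαd : α ≤ d := by
        rcases hα with h | h
        · exact h.2.trans had.le
        · exact h.2
      refine ⟨1, ?_, ?_⟩
      · simp
        omega
      · simpa using isIntervalSum_one hα
    · intro c m hm
      obtain rfl := Finset.mem_singleton.1 (support_monomial_subset hm)
      exact ⟨0, by simp, by simpa using isIntervalSum_zero⟩
    · intro f g _ _ hf hg m hm
      rcases Finset.mem_union.1 (support_add hm) with h | h
      · exact hf m h
      · exact hg m h
    · intro f g _ _ hf hg m hm
      obtain ⟨m₁, h1, m₂, h2, rfl⟩ := Finset.mem_add.1 (support_mul f g hm)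
      obtain ⟨n₁, h3, h4⟩ := hf m₁ h1
      obtain ⟨n₂, h5, h6⟩ := hg m₂ h2
      refine ⟨n₁ + n₂, ?_, h4.add h6⟩
      simp only [Finsupp.add_apply, add_mul]
      omega
  · rw [f.as_sum]
    refine Subalgebra.sum_mem _ fun m hm => ?_
    obtain ⟨n, h1, h2⟩ := h m hm
    exact monomial_mem_coordRing had hbd hE h1 h2 _

/-- To show that `f` lies in a subgroup it suffices to treat its monomials. -/
theorem mem_of_monomials (had : a < d) (hbd : b < d) (hE : E = Set.Icc 0 a ∪ Set.Icc b d)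
    {J : Type*} [SetLike J (coordRing k d E)] [AddSubmonoidClass J (coordRing k d E)] {I : J}
    {f : coordRing k d E} (h : ∀ m ∈ (f : MvPolynomial (Fin 2) k).support, ∀ g : coordRing k d E,
      (g : MvPolynomial (Fin 2) k) = monomial m (coeff m (f : MvPolynomial (Fin 2) k)) → g ∈ I) :
    f ∈ I := by
  have hm : ∀ m ∈ (f : MvPolynomial (Fin 2) k).support,
      monomial m (coeff m (f : MvPolynomial (Fin 2) k)) ∈ coordRing k d E := fun m hm => by
    obtain ⟨n, h1, h2⟩ := (mem_coordRing_iff had hbd hE).1 f.2 m hm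
    exact monomial_mem_coordRing had hbd hE h1 h2 _
  have hf : f = ∑ m ∈ (f : MvPolynomial (Fin 2) k).support.attach,
      (⟨_, hm m m.2⟩ : coordRing k d E) := by
    refine Subtype.ext ?_
    rw [AddSubmonoidClass.coe_finsetSum, Finset.sum_attach _
      (fun m => monomial m (coeff m (f : MvPolynomial (Fin 2) k)))]
    exact (f : MvPolynomial (Fin 2) k).as_sum
  rw [hf]
  exact sum_mem fun m _ => h m m.2 _ rfl

theorem mem_piece_iff {n : ℕ} {f : coordRing k d E} :
    f ∈ piece k d E n ↔ (f : MvPolynomial (Fin 2) k).IsHomogeneous (n * d) := Iff.rfl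

theorem degree_eq_of_isHomogeneous {n : ℕ} {f : MvPolynomial (Fin 2) k} (hf : f.IsHomogeneous n)
    {m : Fin 2 →₀ ℕ} (hm : m ∈ f.support) : m 0 + m 1 = n := by
  rw [← degree_fin_two]
  by_contra h
  exact mem_support_iff.1 hm (hf.coeff_eq_zero h)

end Monomials

/-! ### Degrees in which all monomials occur -/

section Veronese

variable {k : Type*} [Field k] {a b d r : ℕ} {E : Set ℕ}

theorem mem_coordRing_of_le_degree (had : a < d) (hbd : b < d)
    (hE : E = Set.Icc 0 a ∪ Set.Icc b d) (hr : ∀ n, r ≤ n → ∀ α ≤ n * d, IsIntervalSum a b d n α)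
    {f : MvPolynomial (Fin 2) k} (hf : ∀ m ∈ f.support, ∃ n, r ≤ n ∧ m 0 + m 1 = n * d) :
    f ∈ coordRing k d E := by
  refine (mem_coordRing_iff had hbd hE).2 fun m hm => ?_
  obtain ⟨n, h1, h2⟩ := hf m hm
  exact ⟨n, h2, hr n h1 _ (by omega)⟩

/-- Turns the failure of the reduction equation into an exponent missing in degree `n`, which serves
for both the depth and the regularity. -/
theorem not_full_of_gap {n : ℕ} (hn : 1 ≤ n) {α : ℕ} (h₁ : d ≤ α → ¬ IsIntervalSum a b d n (α - d))
    (h₂ : α ≤ n * d → ¬ IsIntervalSum a b d n α) (h₃ : α ≤ (n + 1) * d) :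
    ∃ β ≤ n * d, ¬ IsIntervalSum a b d n β := by
  by_cases h : d ≤ α
  · exact ⟨α - d, by rw [add_mul, one_mul] at h₃; omega, h₁ h⟩
  · have := Nat.le_mul_of_pos_left d hn
    exact ⟨α, by omega, h₂ (by omega)⟩

end Veronese

end MonomialCurve

namespace MonomialCurve

open MvPolynomial

/-! ### Failure of the Cohen–Macaulay property at the vertex -/

section CohenMacaulay

variable {k : Type*} [Field k] {a b d r : ℕ} {E : Set ℕ}

theorem X_zero_pow_mem (h : d ∈ E) : (X 0 ^ d : MvPolynomial (Fin 2) k) ∈ coordRing k d E :=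
  Algebra.subset_adjoin ⟨d, h, by simp [mono]⟩

theorem X_one_pow_mem (h : 0 ∈ E) : (X 1 ^ d : MvPolynomial (Fin 2) k) ∈ coordRing k d E :=
  Algebra.subset_adjoin ⟨0, h, by simp [mono]⟩

/-- The maximal ideal of the elements without constant term. -/
noncomputable def vertexIdeal (k : Type*) [Field k] (d : ℕ) (E : Set ℕ) :
    Ideal (coordRing k d E) :=
  RingHom.ker (constantCoeff.comp (coordRing k d E).val.toRingHom)

theorem mem_vertexIdeal {f : coordRing k d E} :
    f ∈ vertexIdeal k d E ↔ constantCoeff (f : MvPolynomial (Fin 2) k) = 0 := Iff.rfl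

instance : (vertexIdeal k d E).IsPrime := RingHom.ker_isPrime _

/-- The chain is `0`, the kernel of `y ↦ 0`, the vertex ideal; `y^d` and `x^d` show that it is
strict. -/
theorem two_le_height_vertexIdeal (hd : 0 < d) (h0 : 0 ∈ E) (hdE : d ∈ E) :
    2 ≤ (vertexIdeal k d E).height := by
  let ε : MvPolynomial (Fin 2) k →ₐ[k] MvPolynomial (Fin 2) k := aeval ![X 0, 0]
  let P : Ideal (coordRing k d E) := RingHom.ker (ε.comp (coordRing k d E).val)
  have hε : (constantCoeff (R := k)).comp ε.toRingHom = constantCoeff := by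
    refine MvPolynomial.ringHom_ext (fun c => ?_) fun i => ?_
    · simp [ε]
    · fin_cases i <;> simp [ε]
  have : P.IsPrime := RingHom.ker_isPrime _
  have h1 : (⊥ : Ideal (coordRing k d E)) < P := by
    refine bot_lt_iff_ne_bot.2 fun h => ?_
    have hy : (⟨X 1 ^ d, X_one_pow_mem h0⟩ : coordRing k d E) ∈ P := by
      change ε (X 1 ^ d) = 0
      simp [ε, hd.ne']
    rw [h, Ideal.mem_bot] at hy
    exact pow_ne_zero d (X_ne_zero (R := k) (1 : Fin 2)) (congrArg Subtype.val hy)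
  have h2 : P < vertexIdeal k d E := by
    refine lt_of_le_of_ne (fun f hf => ?_) fun h => ?_
    · rw [mem_vertexIdeal, ← hε]
      change constantCoeff (ε (f : MvPolynomial (Fin 2) k)) = 0
      have : ε (f : MvPolynomial (Fin 2) k) = 0 := hf
      rw [this, map_zero]
    · have hx : (⟨X 0 ^ d, X_zero_pow_mem hdE⟩ : coordRing k d E) ∈ vertexIdeal k d E := by
        rw [mem_vertexIdeal]
        simp [hd.ne']
      rw [← h] at hx
      have hx : ε (X 0 ^ d) = 0 := hx
      simp [ε, hd.ne'] at hx
  have h3 := Ideal.height_add_one_le_of_lt_of_isPrime h1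
  have h4 := Ideal.height_add_one_le_of_lt_of_isPrime h2
  calc (2 : ℕ∞) = 0 + 1 + 1 := by norm_num
    _ ≤ _ := (add_le_add_left (add_le_add_left zero_le 1) 1).trans
      ((add_le_add_left h3 1).trans h4)

/-- The monomial of degree `n * d` with `x`-exponent `β`. -/
noncomputable def gapMonomial (k : Type*) [Field k] (d n β : ℕ) : MvPolynomial (Fin 2) k :=
  monomial (Finsupp.single 0 β + Finsupp.single 1 (n * d - β)) 1

theorem isHomogeneous_gapMonomial {n β : ℕ} (hβ : β ≤ n * d) :
    (gapMonomial k d n β).IsHomogeneous (n * d) := by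
  refine isHomogeneous_monomial _ ?_
  rw [degree_fin_two]
  simp
  omega

/-- The constant term of `s` makes the forbidden monomial itself occur in the product, and
membership in `R` is tested monomial by monomial. -/
theorem smul_gapMonomial_notMem (had : a < d) (hbd : b < d)
    (hE : E = Set.Icc 0 a ∪ Set.Icc b d) {n β : ℕ} (hβ : β ≤ n * d)
    (hgap : ¬ IsIntervalSum a b d n β) {s : MvPolynomial (Fin 2) k} (hs : constantCoeff s ≠ 0) :
    s * gapMonomial k d n β ∉ coordRing k d E := by
  intro h
  have h1 : Finsupp.single 0 β + Finsupp.single 1 (n * d - β) ∈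
      (s * gapMonomial k d n β).support := by
    rw [mem_support_iff, gapMonomial, mul_comm s]
    have := coeff_monomial_mul 0 (Finsupp.single 0 β + Finsupp.single 1 (n * d - β)) (1 : k) s
    rw [add_zero] at this
    rwa [this, one_mul]
  obtain ⟨N, h2, h3⟩ := (mem_coordRing_iff had hbd hE).1 h _ h1
  simp only [Finsupp.add_apply, Finsupp.single_eq_same] at h2 h3
  simp only [ne_eq, zero_ne_one, one_ne_zero, not_false_eq_true, Finsupp.single_eq_of_ne, add_zero,
    zero_add] at h2 h3
  have h4 : n = N := Nat.eq_of_mul_eq_mul_right (by omega : 0 < d) (by omega)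
  exact hgap (h4 ▸ h3)

theorem mul_gapMonomial_mem (had : a < d) (hbd : b < d) (hE : E = Set.Icc 0 a ∪ Set.Icc b d)
    (hr : ∀ n, r + 1 ≤ n → ∀ α ≤ n * d, IsIntervalSum a b d n α) {β : ℕ} (hβ : β ≤ r * d)
    {f : MvPolynomial (Fin 2) k} (hf : f ∈ coordRing k d E) (hf0 : constantCoeff f = 0) :
    f * gapMonomial k d r β ∈ coordRing k d E := by
  classical
  refine mem_coordRing_of_le_degree had hbd hE hr fun m hm => ?_
  obtain ⟨m₁, h1, m₂, h2, rfl⟩ := Finset.mem_add.1 (support_mul _ _ hm)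
  obtain ⟨n, h3, -⟩ := (mem_coordRing_iff had hbd hE).1 hf m₁ h1
  have h4 := degree_eq_of_isHomogeneous (isHomogeneous_gapMonomial hβ) h2
  refine ⟨n + r, ?_, ?_⟩
  · rcases Nat.eq_zero_or_pos n with rfl | hn
    · obtain rfl : m₁ = 0 := by
        rw [eq_single_add_single m₁]
        simp at h3
        simp [h3.1, h3.2]
      exact absurd hf0 (mem_support_iff.1 h1)
    · omega
  · simp only [Finsupp.add_apply, add_mul]
    omega

theorem not_isCohenMacaulay (had : a < d) (hbd : b < d) (hE : E = Set.Icc 0 a ∪ Set.Icc b d)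
    (hr : ∀ n, r + 1 ≤ n → ∀ α ≤ n * d, IsIntervalSum a b d n α) {β : ℕ} (hβ : β ≤ r * d)
    (hgap : ¬ IsIntervalSum a b d r β) : ¬ IsCohenMacaulay (coordRing k d E) := by
  intro h
  refine not_isCohenMacaulayLocal_of_mul_mem (coordRing k d E) (vertexIdeal k d E)
    (two_le_height_vertexIdeal (by omega) (hE ▸ Or.inl ⟨le_rfl, Nat.zero_le _⟩)
      (hE ▸ Or.inr ⟨hbd.le, le_rfl⟩)) (gapMonomial k d r β) (fun f hf => ?_) (fun s hs => ?_)
    (h (vertexIdeal k d E))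
  · exact mul_gapMonomial_mem had hbd hE hr hβ f.2 hf
  · exact smul_gapMonomial_notMem had hbd hE hβ hgap hs

end CohenMacaulay

/-! ### The reduction number of the irrelevant ideal -/

section Reduction

variable {k : Type*} [Field k] {a b d r : ℕ} {E : Set ℕ}

theorem Q_eq_span_pair (h0 : 0 ∈ E) (hd : d ∈ E) :
    Q k d E = Ideal.span {⟨X 0 ^ d, X_zero_pow_mem hd⟩, ⟨X 1 ^ d, X_one_pow_mem h0⟩} := by
  rw [Q]
  congr 1
  ext f
  simp [Subtype.ext_iff]

theorem Q_le_irrelevant : Q k d E ≤ irrelevant k d E := by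
  refine Ideal.span_mono ?_
  rintro f (h | h) <;> refine ⟨1, le_rfl, ?_⟩ <;> rw [mem_piece_iff, h, one_mul] <;>
    exact isHomogeneous_X_pow _ _

/-- A monomial of `u * x^d + v * y^d` comes from one of the two products, and its cofactor is a
monomial occurring in an element of `R`, of degree one less. -/
theorem exponent_of_mem_Q (had : a < d) (hbd : b < d) (hE : E = Set.Icc 0 a ∪ Set.Icc b d)
    {f : coordRing k d E} (hf : f ∈ Q k d E) {n : ℕ} {m : Fin 2 →₀ ℕ}
    (hm : m ∈ (f : MvPolynomial (Fin 2) k).support) (hmn : m 0 + m 1 = (n + 1) * d) :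
    (d ≤ m 0 ∧ IsIntervalSum a b d n (m 0 - d)) ∨ (m 0 ≤ n * d ∧ IsIntervalSum a b d n (m 0)) := by
  classical
  rw [Q_eq_span_pair (hE ▸ Or.inl ⟨le_rfl, Nat.zero_le _⟩) (hE ▸ Or.inr ⟨hbd.le, le_rfl⟩),
    Ideal.mem_span_pair] at hf
  obtain ⟨u, v, rfl⟩ := hf
  have h1 : (n + 1) * d = n * d + d := by ring
  have key : ∀ (w : coordRing k d E) (i : Fin 2),
      m ∈ ((w : MvPolynomial (Fin 2) k) * X i ^ d).support →
      d ≤ m i ∧ IsIntervalSum a b d n (m 0 - Finsupp.single i d 0) := by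
    intro w i hw
    rw [X_pow_eq_monomial, mem_support_iff, mul_comm, coeff_monomial_mul'] at hw
    split_ifs at hw with h2
    · have h3 : d ≤ m i := by simpa using h2 i
      rw [one_mul, ← mem_support_iff] at hw
      obtain ⟨N, h4, h5⟩ := (mem_coordRing_iff had hbd hE).1 w.2 _ hw
      have h6 : N = n := by
        refine Nat.eq_of_mul_eq_mul_right (by omega : 0 < d) ?_
        rw [← h4]
        fin_cases i <;> simp at h3 ⊢ <;> omega
      exact ⟨h3, h6 ▸ h5⟩
    · exact absurd rfl hw
  rcases Finset.mem_union.1 (support_add hm) with h | h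
  · exact Or.inl (by simpa using key u 0 h)
  · obtain ⟨h2, h3⟩ := key v 1 h
    exact Or.inr ⟨by omega, by simpa using h3⟩

/-- Monomials of degree `n` lie in the `n`-th power of the irrelevant ideal. -/
theorem mem_irrelevant_pow (had : a < d) (hbd : b < d) (hE : E = Set.Icc 0 a ∪ Set.Icc b d)
    {n : ℕ} {m : Fin 2 →₀ ℕ} (hm : m 0 + m 1 = n * d) (hn : IsIntervalSum a b d n (m 0)) {c : k}
    {f : coordRing k d E} (hf : (f : MvPolynomial (Fin 2) k) = monomial m c) :
    f ∈ irrelevant k d E ^ n := by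
  induction n generalizing m c f with
  | zero => simp
  | succ n ih =>
    obtain ⟨β, hβ, γ, hγ, hm0⟩ := hn.exists_add hbd.le
    have hβd : β ≤ d := by
      rcases hβ with h | h
      · exact h.2.trans had.le
      · exact h.2
    have hγd := hγ.le had.le
    have h1 : (n + 1) * d = n * d + d := by ring
    have h2 : m = (Finsupp.single 0 β + Finsupp.single 1 (d - β)) +
        (Finsupp.single 0 γ + Finsupp.single 1 (n * d - γ)) := by
      ext i
      fin_cases i <;> simp <;> omega
    let u : coordRing k d E := ⟨mono k d β, Algebra.subset_adjoin ⟨β, hE ▸ hβ, rfl⟩⟩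
    have hm' : (Finsupp.single 0 γ + Finsupp.single 1 (n * d - γ) : Fin 2 →₀ ℕ) 0 +
        (Finsupp.single 0 γ + Finsupp.single 1 (n * d - γ) : Fin 2 →₀ ℕ) 1 = n * d := by
      simp
      omega
    have hγ' : IsIntervalSum a b d n
        ((Finsupp.single 0 γ + Finsupp.single 1 (n * d - γ) : Fin 2 →₀ ℕ) 0) := by simpa using hγ
    let v : coordRing k d E := ⟨_, monomial_mem_coordRing had hbd hE hm' hγ' c⟩
    have hfuv : f = u * v := by
      refine Subtype.ext ?_
      rw [hf]
      change monomial m c = mono k d β * monomial _ c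
      rw [mono_eq_monomial, monomial_mul, one_mul, ← h2]
    rw [hfuv, pow_succ']
    refine Ideal.mul_mem_mul (Ideal.subset_span ⟨1, le_rfl, ?_⟩) (ih hm' hγ' rfl)
    rw [mem_piece_iff]
    change (mono k d β).IsHomogeneous (1 * d)
    rw [mono_eq_monomial]
    refine isHomogeneous_monomial _ ?_
    rw [degree_fin_two]
    simp
    omega

theorem degree_of_mem_irrelevant_pow {n : ℕ} {f : coordRing k d E}
    (hf : f ∈ irrelevant k d E ^ n) {m : Fin 2 →₀ ℕ}
    (hm : m ∈ (f : MvPolynomial (Fin 2) k).support) : n * d ≤ m 0 + m 1 := by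
  classical
  have hone : ∀ f ∈ irrelevant k d E, ∀ m ∈ (f : MvPolynomial (Fin 2) k).support,
      d ≤ m 0 + m 1 := by
    intro f hf
    refine Submodule.span_induction (p := fun (f : coordRing k d E) _ =>
      ∀ m ∈ (f : MvPolynomial (Fin 2) k).support, d ≤ m 0 + m 1) ?_ ?_ ?_ ?_ hf
    · rintro f ⟨n, hn, hf⟩ m hm
      rw [degree_eq_of_isHomogeneous (mem_piece_iff.1 hf) hm]
      exact Nat.le_mul_of_pos_left d hn
    · simp
    · intro f g _ _ hf hg m hm
      rcases Finset.mem_union.1 (support_add hm) with h | h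
      · exact hf m h
      · exact hg m h
    · intro u f _ hf m hm
      obtain ⟨m₁, -, m₂, h2, rfl⟩ := Finset.mem_add.1 (support_mul _ _ hm)
      have := hf m₂ h2
      simp only [Finsupp.add_apply]
      omega
  induction n generalizing f m with
  | zero => simp
  | succ n ih =>
    rw [pow_succ'] at hf
    refine Submodule.mul_induction_on (C := fun (f : coordRing k d E) =>
      ∀ m ∈ (f : MvPolynomial (Fin 2) k).support, (n + 1) * d ≤ m 0 + m 1) hf ?_ ?_ m hm
    · intro u hu v hv m hm
      obtain ⟨m₁, h1, m₂, h2, rfl⟩ := Finset.mem_add.1 (support_mul _ _ hm)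
      have := hone u hu m₁ h1
      have := ih hv h2
      simp only [Finsupp.add_apply, add_mul]
      omega
    · intro f g hf hg m hm
      rcases Finset.mem_union.1 (support_add hm) with h | h
      · exact hf m h
      · exact hg m h

theorem monomial_sub_mul_X_pow {m : Fin 2 →₀ ℕ} {i : Fin 2} (h : d ≤ m i) (c : k) :
    (X i ^ d : MvPolynomial (Fin 2) k) * monomial (m - Finsupp.single i d) c = monomial m c := by
  rw [X_pow_eq_monomial, monomial_mul, one_mul, add_tsub_cancel_of_le]
  rwa [Finsupp.single_le_iff]

theorem Q_mul_irrelevant_pow (had : a < d) (hbd : b < d) (hE : E = Set.Icc 0 a ∪ Set.Icc b d)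
    (hr1 : 1 ≤ r) (hr : ∀ n, r ≤ n → ∀ α ≤ n * d, IsIntervalSum a b d n α) :
    Q k d E * irrelevant k d E ^ r = irrelevant k d E ^ (r + 1) := by
  refine le_antisymm ?_ fun f hf => ?_
  · rw [pow_succ']
    exact Ideal.mul_mono_left Q_le_irrelevant
  · refine mem_of_monomials had hbd hE fun m hm g hg => ?_
    obtain ⟨n, h1, -⟩ := (mem_coordRing_iff had hbd hE).1 f.2 m hm
    have h2 := degree_of_mem_irrelevant_pow hf hm
    rw [h1] at h2
    have h3 : r + 1 ≤ n := Nat.le_of_mul_le_mul_right h2 (by omega)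
    obtain ⟨n, rfl⟩ : ∃ n', n = n' + 1 := ⟨n - 1, by omega⟩
    have h4 : (n + 1) * d = n * d + d := by ring
    have h5 : d ≤ n * d := Nat.le_mul_of_pos_left d (by omega)
    -- Pigeonhole: the total degree is at least `2 * d`. The quotient by `X i ^ d` has degree at
    -- least `r * d`, where every monomial lies in `R`.
    obtain ⟨i, hi⟩ : ∃ i, d ≤ m i := by
      by_contra! h
      have := h 0
      have := h 1
      omega
    have hm' : (m - Finsupp.single i d : Fin 2 →₀ ℕ) 0 + (m - Finsupp.single i d : Fin 2 →₀ ℕ) 1 =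
        n * d := by
      fin_cases i <;> simp at hi ⊢ <;> omega
    have hs := hr n (by omega) ((m - Finsupp.single i d : Fin 2 →₀ ℕ) 0) (by omega)
    have hX : (X i ^ d : MvPolynomial (Fin 2) k) ∈ coordRing k d E := by
      fin_cases i
      · exact X_zero_pow_mem (hE ▸ Or.inr ⟨hbd.le, le_rfl⟩)
      · exact X_one_pow_mem (hE ▸ Or.inl ⟨le_rfl, Nat.zero_le _⟩)
    let u : coordRing k d E := ⟨X i ^ d, hX⟩
    let v : coordRing k d E := ⟨_, monomial_mem_coordRing had hbd hE hm' hs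
      (coeff m (f : MvPolynomial (Fin 2) k))⟩
    have hguv : g = u * v := by
      refine Subtype.ext ?_
      rw [hg, MulMemClass.coe_mul, monomial_sub_mul_X_pow hi]
    rw [hguv]
    refine Ideal.mul_mem_mul (Ideal.subset_span ?_)
      (Ideal.pow_le_pow_right (by omega) (mem_irrelevant_pow had hbd hE hm' hs rfl))
    fin_cases i
    · exact Or.inl rfl
    · exact Or.inr rfl

theorem Q_mul_irrelevant_pow_ne (had : a < d) (hbd : b < d)
    (hE : E = Set.Icc 0 a ∪ Set.Icc b d) {n α : ℕ} (hα : IsIntervalSum a b d (n + 1) α)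
    (h₁ : d ≤ α → ¬ IsIntervalSum a b d n (α - d)) (h₂ : α ≤ n * d → ¬ IsIntervalSum a b d n α) :
    Q k d E * irrelevant k d E ^ n ≠ irrelevant k d E ^ (n + 1) := by
  classical
  intro h
  have hαd := hα.le had.le
  obtain ⟨m, rfl, hm⟩ : ∃ m : Fin 2 →₀ ℕ, m 0 = α ∧ m 0 + m 1 = (n + 1) * d :=
    ⟨Finsupp.single 0 α + Finsupp.single 1 ((n + 1) * d - α), by simp, by simp; omega⟩
  obtain ⟨f, hfm⟩ : ∃ f : coordRing k d E, (f : MvPolynomial (Fin 2) k) = monomial m 1 :=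
    ⟨⟨_, monomial_mem_coordRing had hbd hE hm hα 1⟩, rfl⟩
  have hf : f ∈ Q k d E * irrelevant k d E ^ n := by
    rw [h]
    exact mem_irrelevant_pow had hbd hE hm hα hfm
  have hmf : m ∈ (f : MvPolynomial (Fin 2) k).support := by
    rw [hfm, mem_support_iff, coeff_monomial, if_pos rfl]
    exact one_ne_zero
  -- The power may be dropped: for a monomial of degree `n + 1`, membership in `Q` already forces a
  -- cofactor of degree `n`.
  have hQ : Q k d E * irrelevant k d E ^ n ≤ Q k d E := Ideal.mul_le_left
  rcases exponent_of_mem_Q had hbd hE (hQ hf) hmf hm with h | h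
  · exact h₁ h.1 h.2
  · exact h₂ h.1 h.2

end Reduction

end MonomialCurve

namespace MonomialCurve

open MvPolynomial

/-! ### The regularity of the coordinate ring -/

section Regularity

variable {k : Type*} [Field k] {a b d r : ℕ} {E : Set ℕ}

theorem coe_smul_coordRing (p : MvPolynomial E k) (z : coordRing k d E) :
    ((p • z : coordRing k d E) : MvPolynomial (Fin 2) k) =
      (presentation k d E p : MvPolynomial (Fin 2) k) * z := rfl

theorem coe_presentation (p : MvPolynomial E k) :
    (presentation k d E p : MvPolynomial (Fin 2) k) = aeval (fun α : E => mono k d α) p := by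
  have : (coordRing k d E).val.comp (presentation k d E) = aeval fun α : E => mono k d α := by
    ext α
    simp [presentation]
  exact DFunLike.congr_fun this p

theorem coe_X_smul (s : E) (z : coordRing k d E) :
    (((X s : MvPolynomial E k) • z : coordRing k d E) : MvPolynomial (Fin 2) k) =
      mono k d s * z := by
  rw [coe_smul_coordRing, coe_presentation, aeval_X]

instance instIsScalarTowerCoordRing : IsScalarTower k (MvPolynomial E k) (coordRing k d E) where
  smul_assoc c p z := by
    refine Subtype.ext ?_
    rw [coe_smul_coordRing, map_smul]
    change (c • (presentation k d E p : MvPolynomial (Fin 2) k)) * _ = c • (_ * _)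
    rw [smul_mul_assoc]
    rfl

instance instFiniteCoordRing : Module.Finite (MvPolynomial E k) (coordRing k d E) := by
  refine Module.Finite.of_surjective
    (LinearMap.toSpanSingleton (MvPolynomial E k) (coordRing k d E) 1) fun f => ?_
  obtain ⟨p, rfl⟩ := presentation_surjective k d E f
  refine ⟨p, Subtype.ext ?_⟩
  rw [LinearMap.toSpanSingleton_apply, coe_smul_coordRing, OneMemClass.coe_one, mul_one]

theorem isHomogeneous_mono {α : ℕ} (hα : α ≤ d) : (mono k d α).IsHomogeneous d := by
  have := (isHomogeneous_X_pow (R := k) (0 : Fin 2) α).mul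
    (isHomogeneous_X_pow (R := k) (1 : Fin 2) (d - α))
  rwa [Nat.add_sub_cancel' hα] at this

theorem isHomogeneous_presentation (hE : ∀ α ∈ E, α ≤ d) {n : ℕ} {p : MvPolynomial E k}
    (hp : p.IsHomogeneous n) :
    (presentation k d E p : MvPolynomial (Fin 2) k).IsHomogeneous (n * d) := by
  rw [coe_presentation, mul_comm]
  exact hp.aeval _ fun α => isHomogeneous_mono (hE α α.2)

theorem homogeneousComponent_mem (had : a < d) (hbd : b < d)
    (hE : E = Set.Icc 0 a ∪ Set.Icc b d) (n : ℕ) {f : MvPolynomial (Fin 2) k}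
    (hf : f ∈ coordRing k d E) : homogeneousComponent n f ∈ coordRing k d E := by
  rw [mem_coordRing_iff had hbd hE] at hf ⊢
  intro m hm
  refine hf m ?_
  rw [mem_support_iff, coeff_homogeneousComponent] at hm
  rw [mem_support_iff]
  exact fun h => hm (by simp [h])

/-- The projection of the coordinate ring onto its piece of degree `n`. -/
noncomputable def pieceProj (k : Type*) [Field k] (had : a < d) (hbd : b < d)
    (hE : E = Set.Icc 0 a ∪ Set.Icc b d) (n : ℕ) : coordRing k d E →ₗ[k] coordRing k d E :=
  LinearMap.codRestrict (coordRing k d E).toSubmodule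
    ((homogeneousComponent (n * d)).comp (coordRing k d E).val.toLinearMap)
    fun f => homogeneousComponent_mem had hbd hE _ f.2

theorem coe_pieceProj (had : a < d) (hbd : b < d) (hE : E = Set.Icc 0 a ∪ Set.Icc b d) (n : ℕ)
    (f : coordRing k d E) : (pieceProj k had hbd hE n f : MvPolynomial (Fin 2) k) =
      homogeneousComponent (n * d) (f : MvPolynomial (Fin 2) k) := rfl

theorem le_of_mem_exponents (had : a < d) (hE : E = Set.Icc 0 a ∪ Set.Icc b d) {α : ℕ}
    (hα : α ∈ E) : α ≤ d := by
  rw [hE] at hα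
  rcases hα with h | h
  · exact h.2.trans had.le
  · exact h.2

theorem isGrading_piece (had : a < d) (hbd : b < d) (hE : E = Set.Icc 0 a ∪ Set.Icc b d) :
    IsGrading E (piece k d E) (pieceProj k had hbd hE) where
  proj_mem j x := homogeneousComponent_isHomogeneous _ _
  proj_eq_self j x hx := by
    refine Subtype.ext ?_
    rw [coe_pieceProj, homogeneousComponent_of_mem (mem_piece_iff.1 hx), if_pos rfl]
  proj_eq_zero i j hij x hx := by
    refine Subtype.ext ?_
    rw [coe_pieceProj, homogeneousComponent_of_mem (mem_piece_iff.1 hx), if_neg]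
    · rfl
    · exact fun h => hij (Nat.eq_of_mul_eq_mul_right (by omega) h).symm
  eq_sum f := by
    refine ⟨(f : MvPolynomial (Fin 2) k).totalDegree + 1, Subtype.ext ?_⟩
    rw [AddSubmonoidClass.coe_finsetSum]
    simp only [coe_pieceProj]
    ext m
    rw [coeff_sum]
    simp only [coeff_homogeneousComponent]
    by_cases hm : m ∈ (f : MvPolynomial (Fin 2) k).support
    · obtain ⟨n, h1, -⟩ := (mem_coordRing_iff had hbd hE).1 f.2 m hm
      rw [← degree_fin_two] at h1
      rw [Finset.sum_eq_single n]
      · rw [if_pos h1]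
      · intro j _ hj
        rw [if_neg]
        exact fun h => hj (Nat.eq_of_mul_eq_mul_right (by omega : 0 < d) (h.symm.trans h1))
      · intro hn
        exfalso
        apply hn
        have h2 : m.degree ≤ (f : MvPolynomial (Fin 2) k).totalDegree := le_totalDegree hm
        have h3 : n ≤ n * d := Nat.le_mul_of_pos_right n (by omega)
        exact Finset.mem_range.2 (by omega)
    · rw [notMem_support_iff.1 hm]
      simp
  smul_mem i m p hp x hx := by
    rw [mem_piece_iff, coe_smul_coordRing, add_mul, add_comm]
    exact (isHomogeneous_presentation (fun α => le_of_mem_exponents had hE) hp).mul hx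

section Elements

variable {s t : E}

theorem regularFrom_origin (hs : (s : ℕ) = 0) : RegularFrom [s] 0 (piece k d E) := by
  refine ⟨fun j _ z _ h => ?_, trivial⟩
  have h : (X s : MvPolynomial E k) • z = 0 := h
  have h1 := congrArg (Subtype.val : coordRing k d E → MvPolynomial (Fin 2) k) h
  rw [coe_X_smul, hs, mono, pow_zero, one_mul] at h1
  have h2 : (z : MvPolynomial (Fin 2) k) = 0 :=
    (mul_eq_zero.1 h1).resolve_left (pow_ne_zero _ (X_ne_zero _))
  exact (Submodule.mem_bot k).2 (Subtype.ext h2)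

theorem piece_succ_le_varSpan (had : a < d) (hbd : b < d) (hE : E = Set.Icc 0 a ∪ Set.Icc b d)
    (hr1 : 1 ≤ r) (hr : ∀ n, r ≤ n → ∀ α ≤ n * d, IsIntervalSum a b d n α)
    (hs : (s : ℕ) = 0) (ht : (t : ℕ) = d) {L : List E} (hsL : s ∈ L) (htL : t ∈ L) {j : ℕ}
    (hj : r ≤ j) : piece k d E (j + 1) ≤ varSpan L (piece k d E j) := by
  intro f hf
  refine mem_of_monomials had hbd hE fun m hm g hg => ?_
  have h1 := degree_eq_of_isHomogeneous (mem_piece_iff.1 hf) hm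
  have h4 : (j + 1) * d = j * d + d := by ring
  have h5 : d ≤ j * d := Nat.le_mul_of_pos_left d (by omega)
  obtain ⟨i, hi⟩ : ∃ i, d ≤ m i := by
    by_contra! h
    have := h 0
    have := h 1
    omega
  have hm' : (m - Finsupp.single i d : Fin 2 →₀ ℕ) 0 + (m - Finsupp.single i d : Fin 2 →₀ ℕ) 1 =
      j * d := by
    fin_cases i <;> simp at hi ⊢ <;> omega
  have hsum := hr j hj ((m - Finsupp.single i d : Fin 2 →₀ ℕ) 0) (by omega)
  obtain ⟨v, hv⟩ : ∃ v : coordRing k d E, (v : MvPolynomial (Fin 2) k) =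
      monomial (m - Finsupp.single i d) (coeff m (f : MvPolynomial (Fin 2) k)) :=
    ⟨⟨_, monomial_mem_coordRing had hbd hE hm' hsum _⟩, rfl⟩
  have hvp : v ∈ piece k d E j := by
    rw [mem_piece_iff, hv]
    exact isHomogeneous_monomial _ (by rw [degree_fin_two, hm'])
  obtain ⟨u, hu, hX⟩ : ∃ u ∈ L, mono k d u = X i ^ d := by
    fin_cases i
    · exact ⟨t, htL, by simp [mono, ht]⟩
    · exact ⟨s, hsL, by simp [mono, hs]⟩
  have hguv : g = (X u : MvPolynomial E k) • v := by
    refine Subtype.ext ?_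
    rw [hg, coe_X_smul, hv, hX, monomial_sub_mul_X_pow hi]
  rw [hguv]
  exact smul_mem_varSpan_of_mem hu hvp

/-- From `x^d z = y^d w` follows `z = y^d v` in `k[x, y]`, and `v` lies in `R` because its degree is
at least `r`. -/
theorem regularFrom_pair (had : a < d) (hbd : b < d) (hE : E = Set.Icc 0 a ∪ Set.Icc b d)
    (hr : ∀ n, r ≤ n → ∀ α ≤ n * d, IsIntervalSum a b d n α)
    (hs : (s : ℕ) = 0) (ht : (t : ℕ) = d) : RegularFrom [t, s] r (piece k d E) := by
  refine ⟨fun j hj z hz h => ?_,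
    fun j _ z hz h => (regularFrom_origin hs).1 j (Nat.zero_le _) z hz h, trivial⟩
  obtain ⟨w, -, y, hy, hwy⟩ := mem_varSpan_cons.1 h
  obtain rfl : y = 0 := hy
  rw [add_zero] at hwy
  have h1 := congrArg (Subtype.val : coordRing k d E → MvPolynomial (Fin 2) k) hwy
  simp only [coe_X_smul, hs, ht, mono, pow_zero, one_mul, Nat.sub_zero, Nat.sub_self,
    mul_one] at h1
  have hprime : Prime (X 1 : MvPolynomial (Fin 2) k) := X_prime
  have hnd : ¬ (X 1 : MvPolynomial (Fin 2) k) ∣ X 0 ^ d := fun h => by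
    have := hprime.dvd_of_dvd_pow h
    rw [X_dvd_X] at this
    exact one_ne_zero this
  obtain ⟨v, hv⟩ := hprime.pow_dvd_of_dvd_mul_left d hnd ⟨_, h1.symm⟩
  have hvhom : v.IsHomogeneous (j * d) := by
    intro m hm
    rw [show (1 : Fin 2 → ℕ) = fun _ => 1 from rfl, ← Finsupp.degree_eq_weight_one, degree_fin_two]
    have h2 : Finsupp.single 1 d + m ∈ (z : MvPolynomial (Fin 2) k).support := by
      rw [hv, mem_support_iff, X_pow_eq_monomial, coeff_monomial_mul, one_mul]
      exact hm
    have h3 := degree_eq_of_isHomogeneous (mem_piece_iff.1 hz) h2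
    simp [add_mul] at h3
    omega
  have hvR : v ∈ coordRing k d E := mem_coordRing_of_le_degree had hbd hE hr fun m hm =>
    ⟨j, hj, degree_eq_of_isHomogeneous hvhom hm⟩
  have hz' : z = (X s : MvPolynomial E k) • (⟨v, hvR⟩ : coordRing k d E) := by
    refine Subtype.ext ?_
    rw [coe_X_smul, hs, hv]
    simp [mono]
  rw [hz']
  exact smul_mem_varSpan_of_mem (List.mem_singleton_self s) hvhom

/-- The remaining variables satisfy the condition trivially, since `R` modulo `x^d, y^d` is zero in
degrees above `r`. -/
theorem regularFrom_append (had : a < d) (hbd : b < d) (hE : E = Set.Icc 0 a ∪ Set.Icc b d)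
    (hr1 : 1 ≤ r) (hr : ∀ n, r ≤ n → ∀ α ≤ n * d, IsIntervalSum a b d n α)
    (hs : (s : ℕ) = 0) (ht : (t : ℕ) = d) (L : List E) :
    RegularFrom (L ++ [t, s]) r (piece k d E) := by
  induction L with
  | nil => exact regularFrom_pair had hbd hE hr hs ht
  | cons u L ih =>
    exact ⟨fun j hj z hz _ =>
      piece_succ_le_varSpan had hbd hE hr1 hr hs ht (by simp) (by simp) hj hz, ih⟩

/-- The element is `y^d h` with `h` the missing monomial: it is not in `y^d R` because `h ∉ R`, and
a generator `g` of `R` sends it to `y^d (g h)` with `g h ∈ R`. -/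
theorem hasSocle_gapMonomial (had : a < d) (hbd : b < d) (hE : E = Set.Icc 0 a ∪ Set.Icc b d)
    (hr : ∀ n, r + 1 ≤ n → ∀ α ≤ n * d, IsIntervalSum a b d n α) {β : ℕ} (hβ : β ≤ r * d)
    (hgap : ¬ IsIntervalSum a b d r β) (hs : (s : ℕ) = 0) :
    HasSocle [s] r (piece k d E) := by
  have hh := isHomogeneous_gapMonomial (k := k) hβ
  have hmem : ∀ u : E, mono k d u * gapMonomial k d r β ∈ coordRing k d E ∧
      (mono k d u * gapMonomial k d r β).IsHomogeneous ((r + 1) * d) := by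
    intro u
    have h1 := (isHomogeneous_mono (k := k) (le_of_mem_exponents had hE u.2)).mul hh
    rw [show d + r * d = (r + 1) * d by ring] at h1
    exact ⟨mem_coordRing_of_le_degree had hbd hE hr fun m hm =>
      ⟨r + 1, le_rfl, degree_eq_of_isHomogeneous h1 hm⟩, h1⟩
  have hs1 : mono k d s = X 1 ^ d := by simp [mono, hs]
  refine ⟨⟨_, (hmem s).1⟩, (hmem s).2, fun h => ?_, fun u => ?_⟩
  · obtain ⟨w, -, y, hy, hwy⟩ := mem_varSpan_cons.1 h
    obtain rfl : y = 0 := hy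
    rw [add_zero] at hwy
    have h1 := congrArg (Subtype.val : coordRing k d E → MvPolynomial (Fin 2) k) hwy
    rw [coe_X_smul] at h1
    have h2 := mul_left_cancel₀ (hs1 ▸ pow_ne_zero d (X_ne_zero 1)) h1
    refine smul_gapMonomial_notMem (k := k) had hbd hE hβ hgap (s := 1) (by simp) ?_
    rw [one_mul, ← h2]
    exact w.2
  · have hu : (X u : MvPolynomial E k) • (⟨_, (hmem s).1⟩ : coordRing k d E) =
        (X s : MvPolynomial E k) • (⟨_, (hmem u).1⟩ : coordRing k d E) := by
      refine Subtype.ext ?_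
      rw [coe_X_smul, coe_X_smul]
      ring
    rw [hu]
    exact smul_mem_varSpan_of_mem (List.mem_singleton_self s) (hmem u).2

end Elements

theorem hasReg (had : a < d) (hbd : b < d) (hE : E = Set.Icc 0 a ∪ Set.Icc b d)
    (hr : ∀ n, r + 1 ≤ n → ∀ α ≤ n * d, IsIntervalSum a b d n α) {β : ℕ} (hβ : β ≤ r * d)
    (hgap : ¬ IsIntervalSum a b d r β) : HasReg k d E (r + 1 : ℕ) := by
  classical
  have hfin : Finite E := Set.Finite.to_subtype
    (hE ▸ (Set.finite_Icc 0 a).union (Set.finite_Icc b d))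
  have := Fintype.ofFinite E
  let s : E := ⟨0, hE ▸ Or.inl ⟨le_rfl, Nat.zero_le _⟩⟩
  let t : E := ⟨d, hE ▸ Or.inr ⟨hbd.le, le_rfl⟩⟩
  have hst : t ≠ s := fun h => by
    have : d = 0 := congrArg Subtype.val h
    omega
  let L : List E := ((Finset.univ.erase s).erase t).toList
  have hL : ∀ u, u ∈ L ↔ u ≠ t ∧ u ≠ s := by simp [L]
  have happ : L ++ [t] ++ [s] = L ++ [t, s] := by simp
  refine (isGrading_piece had hbd hE).hasRegularity (L := L ++ [t]) (s := s) ?_ ?_ ?_ ?_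
    (regularFrom_origin rfl) (hasSocle_gapMonomial had hbd hE hr hβ hgap rfl)
  · rw [happ, List.nodup_append]
    refine ⟨Finset.nodup_toList _, by simp [hst], ?_⟩
    rintro u hu v hv rfl
    rw [hL] at hu
    simp at hv
    tauto
  · intro u
    rw [happ]
    simp only [List.mem_append, List.mem_cons, List.not_mem_nil, hL]
    tauto
  · rw [happ]
    exact regularFrom_append had hbd hE (Nat.le_add_left 1 r) hr rfl rfl L
  · intro j hj
    exact piece_succ_le_varSpan had hbd hE (Nat.le_add_left 1 r) hr (s := s) (t := t) rfl rfl
      (by simp) (by simp) hj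

end Regularity

end MonomialCurve

theorem mainTheorem5 (k : Type*) [Field k] (a b d : ℕ) (ha : 1 ≤ a) (hab : a + 2 ≤ b)
    (hbd : b < d) (E : Set ℕ) (hE : E = Set.Icc 0 a ∪ Set.Icc b d) :
    ¬ IsCohenMacaulay (MonomialCurve.coordRing k d E) ∧
    IsReduction (MonomialCurve.Q k d E) (MonomialCurve.irrelevant k d E) ∧
    MonomialCurve.HasReg k d E
      (reductionNumber (MonomialCurve.Q k d E) (MonomialCurve.irrelevant k d E)) ∧
    (reductionNumber (MonomialCurve.Q k d E) (MonomialCurve.irrelevant k d E) : ℤ) =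
      if (a : ℤ) ≤ d - b then ⌈((b : ℚ) - 1) / a⌉ else ⌈((d : ℚ) - a - 1) / (d - b)⌉ := by
  have had : a < d := by omega
  obtain ⟨r, hformula, hr2, hr, hgap⟩ := exists_conductor ha hab hbd
  have hred := MonomialCurve.Q_mul_irrelevant_pow (k := k) had hbd hE (by omega : 1 ≤ r) hr
  have hnum : reductionNumber (MonomialCurve.Q k d E) (MonomialCurve.irrelevant k d E) = r := by
    refine le_antisymm (Nat.sInf_le hred) (le_csInf ⟨r, hred⟩ fun n hn => ?_)
    by_contra! hlt
    obtain ⟨α, h1, h2, h3⟩ := hgap n hlt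
    exact MonomialCurve.Q_mul_irrelevant_pow_ne had hbd hE h1 h2 h3 hn
  rw [hnum]
  -- The missing monomial sits one degree below the conductor; since the conductor is at least `2`,
  -- that degree is positive, as `not_full_of_gap` requires.
  obtain ⟨r, rfl⟩ : ∃ r', r = r' + 1 := ⟨r - 1, by omega⟩
  obtain ⟨α, h1, h2, h3⟩ := hgap r (Nat.lt_succ_self r)
  obtain ⟨β, hβ, hβgap⟩ := MonomialCurve.not_full_of_gap (by omega) h2 h3 (h1.le had.le)
  exact ⟨MonomialCurve.not_isCohenMacaulay had hbd hE hr hβ hβgap,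
    ⟨MonomialCurve.Q_le_irrelevant, _, hred⟩,
    MonomialCurve.hasReg had hbd hE hr hβ hβgap, hformula⟩
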